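/- For $y\in\mathbb R^3$ with $|y|\ge 1$ put $\psi(y)=\sqrt{|y|^2-1}$. Let $\mathcal H^3=\{(y,\psi(y)):y\in\mathbb R^3,\ |y|\ge 1\}\subset\mathbb R^4$ be the upper half of the one-sheeted hyperboloid, with the measure $\mu$ defined by $$\int g\,d\mu=\int_{|y|>1}g(y,\psi(y))\,\frac{dy}{\psi(y)},$$ and let $\overline{\mathcal H}^3=\mathcal H^3\cup(-\mathcal H^3)$ be the full one-sheeted hyperboloid with the measure $\bar\mu=\mu+\mu_-$, where $\mu_-$ is the image of $\mu$ under $(y,s)\mapsto(-y,-s)$. For complex valued $f\in L^2(\mathcal H^3,\mu)$, respectively $f\in L^2(\overline{\mathcal H}^3,\bar\mu)$, let $$Tf(x,t)=\int e^{i(x\cdot y+ts)}f(y,s)\,d\mu(y,s),\qquad \overline Tf(x,t)=\int e^{i(x\cdot y+ts)}f(y,s)\,d\bar\mu(y,s),\qquad (x,t)\in\mathbb R^3\times\mathbb R,$$ where the right-hand sides are understood as the tempered distributions $\widehat{f\mu}(-x,-t)$ and $\widehat{f\bar\mu}(-x,-t)$ on $\mathbb R^4$, and $\|\cdot\|_{L^4(\mathbb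 R^4)}=\infty$ for a distribution that is not in $L^4(\mathbb R^4)$. For $k\in\mathbb N=\{0,1,2,\dots\}$ let $f_k(y,s)=f(y,s)\mathbf 1_{\{2^k\le|y|<2^{k+1}\}}$. (i) There is a constant $C<\infty$ such that for every $f\in L^2(\mathcal H^3,\mu)$ $$\|Tf\|_{L^4(\mathbb R^4)}\le C\Bigl(\sum_{k\ge 0}\|f_k\|_{L^2(\mu)}^3\Bigr)^{1/3}.$$ (ii) There is a constant $C<\infty$ such that for every $f\in L^2(\mathcal H^3,\mu)$ $$\|Tf\|_{L^4(\mathbb R^4)}\le C\,\sup_{k\in\mathbb N}\|f_k\|_{L^2(\mu)}^{1/3}\;\|f\|_{L^2(\mu)}^{2/3}.$$ (iii) The statements (i) and (ii) also hold with $\overline T$, $\overline{\mathcal H}^3$, $\bar\mu$ in place of $T$, $\mathcal H^3$, $\mu$. (iv) Let $\overline{\mathbf H}_4=\sup_{0\ne f\in L^2(\bar\mu)}\|\overline Tf\|_{L^4(\mathbb R^4)}/\|f\|_{L^2(\bar\mu)}$, and let $(f_n)_n$ be an $L^2$-normalized extremizing sequence, that is, $\|f_n\|_{L^2(\bar\mu)}=1$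 for all $n$ and $\|\overline Tf_n\|_{L^4(\mathbb R^4)}\to\overline{\mathbf H}_4$. Then no subsequence $(f_{n_j})_j$ is vanishing, where vanishing means that for every $R<\infty$ $$\lim_{j\to\infty}\ \sup_{\ell\in\mathbb N}\int_{2^{\ell-R}\le|y|\le 2^{\ell+R}}|f_{n_j}(y,s)|^2\,d\bar\mu(y,s)=0.$$ The same holds with $T$, $\mu$ and the corresponding best constant $\mathbf H_4$ in place of $\overline T$, $\bar\mu$, $\overline{\mathbf H}_4$. -/

import Mathlib

open MeasureTheory Filter Topology
open scoped ENNReal NNReal SchwartzMap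

noncomputable section

namespace Hyperboloid

/-- The Euclidean space `ℝ³`. -/
abbrev R3 : Type := EuclideanSpace ℝ (Fin 3)

/-- The Euclidean space `ℝ⁴ = ℝ³ × ℝ`, with points `z = (x, t)`, inner product
`⟪(x, t), (y, s)⟫ = x · y + t s`, and Lebesgue measure as `volume`. -/
abbrev R4 : Type := WithLp 2 (R3 × ℝ)

/-- The graph map `y ↦ (y, √(|y|² - 1))` onto the upper half `ℋ³` of the one-sheeted hyperboloid. -/
def lift (y : R3) : R4 := WithLp.toLp 2 (y, √(‖y‖ ^ 2 - 1))

/-- The measure `μ` on `ℋ³`, as a measure on `ℝ⁴` carried by `ℋ³`: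
`∫ g dμ = ∫_{|y| > 1} g(y, √(|y|² - 1)) dy / √(|y|² - 1)`. -/
def mu : Measure R4 :=
  (((volume : Measure R3).restrict {y | 1 < ‖y‖}).withDensity
    (fun y => ENNReal.ofReal (1 / √(‖y‖ ^ 2 - 1)))).map lift

theorem measurable_lift : Measurable lift :=
  ((WithLp.prod_continuous_toLp 2 R3 ℝ).comp
    (by fun_prop : Continuous fun y : R3 => (y, √(‖y‖ ^ 2 - 1)))).measurable

/-- The defining formula of `μ`. -/
theorem lintegral_mu (g : R4 → ℝ≥0∞) (hg : Measurable g) :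
    ∫⁻ z, g z ∂mu = ∫⁻ y in {y : R3 | 1 < ‖y‖},
      ENNReal.ofReal (1 / √(‖y‖ ^ 2 - 1)) * g (WithLp.toLp 2 (y, √(‖y‖ ^ 2 - 1))) := by
  rw [mu, lintegral_map hg measurable_lift]
  exact lintegral_withDensity_eq_lintegral_mul _ (by fun_prop) (hg.comp measurable_lift)

/-- The Lorentz invariant measure `μ̄ = μ₊ + μ₋` on the full one-sheeted hyperboloid, where `μ₊ = μ`
and `μ₋` is the reflection of `μ` through the origin. -/
def muBar : Measure R4 := mu + mu.map (fun z => -z)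

/-- `IsExtension ν f F` says that `F ∈ L⁴(ℝ⁴)` is the adjoint Fourier restriction
`(x, t) ↦ ∫ e^{i (x · y + t s)} f(y, s) dν(y, s)` of `f`. For `f ∈ L²(ν)` this integral need not
converge absolutely, so it is read as the tempered distribution `z ↦ (f ν)^(-z)`, that is, the
identity is tested against all Schwartz functions. It determines `F` almost everywhere. -/
def IsExtension (ν : Measure R4) (f F : R4 → ℂ) : Prop :=
  MemLp F 4 volume ∧
    ∀ φ : 𝓢(R4, ℂ),
      ∫ z, F z * φ z =
        ∫ ξ, (∫ z, Complex.exp (Complex.I * (inner ℝ z ξ : ℝ)) * φ z) * f ξ ∂ν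

/-- The adjoint Fourier restriction in `L⁴(ℝ⁴)` is unique. -/
theorem IsExtension.ae_eq {ν : Measure R4} {f F G : R4 → ℂ} (hF : IsExtension ν f F)
    (hG : IsExtension ν f G) : F =ᵐ[volume] G := by
  refine ae_eq_of_integral_contDiff_smul_eq (hF.1.locallyIntegrable (by norm_num))
    (hG.1.locallyIntegrable (by norm_num)) fun g hg hc => ?_
  have hc' : HasCompactSupport (fun z => (g z : ℂ)) :=
    hc.comp_left (g := fun x : ℝ => (x : ℂ)) (by simp)
  have hg' : ContDiff ℝ (⊤ : ℕ∞) (fun z => (g z : ℂ)) := Complex.ofRealCLM.contDiff.comp hg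
  have := (hF.2 (hc'.toSchwartzMap hg')).trans (hG.2 (hc'.toSchwartzMap hg')).symm
  simpa [mul_comm] using this

/-- Where the defining integral converges absolutely, the adjoint Fourier restriction is given by
it. -/
theorem isExtension_integral {ν : Measure R4} [SFinite ν] {f : R4 → ℂ} (hf : Integrable f ν)
    (hF : MemLp (fun z => ∫ ξ, Complex.exp (Complex.I * (inner ℝ z ξ : ℝ)) * f ξ ∂ν) 4 volume) :
    IsExtension ν f (fun z => ∫ ξ, Complex.exp (Complex.I * (inner ℝ z ξ : ℝ)) * f ξ ∂ν) := by
  refine ⟨hF, fun φ => ?_⟩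
  simp_rw [← integral_mul_const]
  rw [integral_integral_swap]
  · congr! 4; ring
  · have h0 := (φ.integrable (μ := volume)).mul_prod hf
    have : Integrable (fun p : R4 × R4 =>
        Complex.exp (Complex.I * (inner ℝ p.1 p.2 : ℝ)) * (φ p.1 * f p.2)) (volume.prod ν) := by
      refine h0.bdd_mul (c := 1) (by fun_prop) (ae_of_all _ fun p => ?_)
      rw [mul_comm, Complex.norm_exp_ofReal_mul_I]
    refine this.congr (ae_of_all _ fun p => ?_)
    simp [Function.uncurry]; ring

/-- The norm in `L⁴(ℝ⁴)` of the adjoint Fourier restriction of `f` with respect to `ν`; it is `∞` if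
that tempered distribution does not belong to `L⁴(ℝ⁴)`. The infimum runs over the representatives of
at most one element of `L⁴(ℝ⁴)`. For `ν = mu` it is `‖T f‖₄`, for `ν = muBar` it is `‖T̄ f‖₄`. -/
def extensionNorm (ν : Measure R4) (f : R4 → ℂ) : ℝ≥0∞ :=
  ⨅ (F : R4 → ℂ) (_ : IsExtension ν f F), eLpNorm F 4 volume

/-- The dyadic piece `f_k = f 𝟙_{2^k ≤ |y| < 2^(k+1)}`, where `|y|` is the norm of the component of
`(y, s)` in `ℝ³`. -/
def dyadicPiece (f : R4 → ℂ) (k : ℕ) : R4 → ℂ :=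
  Set.indicator {ξ : R4 | (2 : ℝ) ^ k ≤ ‖ξ.fst‖ ∧ ‖ξ.fst‖ < (2 : ℝ) ^ (k + 1)} f

/-- The best constant `sup_{0 ≠ f ∈ L²(ν)} ‖(f ν)^‖₄ / ‖f‖₂` of the `L² → L⁴` adjoint restriction
inequality. -/
def bestConstant (ν : Measure R4) : ℝ≥0∞ :=
  ⨆ (f : R4 → ℂ) (_ : MemLp f 2 ν) (_ : eLpNorm f 2 ν ≠ 0), extensionNorm ν f / eLpNorm f 2 ν

/-- `L²`-normalized extremizing sequences of the `L² → L⁴` adjoint restriction inequality. -/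
structure IsExtremizingSeq (ν : Measure R4) (f : ℕ → R4 → ℂ) : Prop where
  memLp : ∀ n, MemLp (f n) 2 ν
  norm_eq_one : ∀ n, eLpNorm (f n) 2 ν = 1
  tendsto : Tendsto (fun n => extensionNorm ν (f n)) atTop (𝓝 (bestConstant ν))

/-- Vanishing: for every `R`, the supremum over `ℓ ∈ ℕ` of
`∫_{2^(ℓ-R) ≤ |y| ≤ 2^(ℓ+R)} |f_n|² dν` tends to `0` as `n → ∞`. -/
def IsVanishing (ν : Measure R4) (f : ℕ → R4 → ℂ) : Prop :=
  ∀ R : ℝ, Tendsto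
    (fun n => ⨆ ℓ : ℕ,
      ∫⁻ ξ in {ξ : R4 | (2 : ℝ) ^ ((ℓ : ℝ) - R) ≤ ‖ξ.fst‖ ∧ ‖ξ.fst‖ ≤ (2 : ℝ) ^ ((ℓ : ℝ) + R)},
        ‖f n ξ‖ₑ ^ 2 ∂ν)
    atTop (𝓝 0)

end Hyperboloid

end

/-! The exponent 4 is even, so `‖Tf‖₄⁴` is the `L²` norm squared of `(Tf)²`, and Plancherel turns
products of extensions into convolutions of measures on the hyperboloid.

The geometric input is the convolution of the pieces of `μ` over the annuli `|y| ~ 2^k` and `|y| ~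
2^l`, `k ≤ l`. For fixed `x = y + y'`, bipolar coordinates `a = |y|²`, `b = |x - y|²` bound `dy` by
`π / (2|x|) da db`, and `s = √(a - 1)` turns the weight `da / √(a - 1)` into `2 ds`. The range `s <
2^(k+1)` then gives density at most a multiple of `2^k / |x|`. Cancellation in `y + y'` could make
`|x|` small; if both points lie in one octant of `ℝ³` then `y · y' ≥ 0`, so `|x| ≥ 2^l` and the
density is `O(2^(-|k-l|))` (`setLIntegral_add_le`).

By duality and Cauchy–Schwarz (`lintegral_extInt_mul_extInt_le`) the product of the extensions of
two pieces decays geometrically in `|k - l|` in `L²`. Expanding the fourth power of the sum and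
pairing factors so that the most distant scales meet (`lintegral_tsum_pow_four_le`) gives `‖Tf‖₄ ≤ C
(∑ ‖f_k‖⁴)^(1/4)`, first on each octant, then for `μ` by adding eight octants and for `μ̄` by
reflection. This is stronger than the claimed `ℓ³` bound, and the supremum bound follows from `∑
‖f_k‖³ ≤ sup ‖f_k‖ ∑ ‖f_k‖²`.

A vanishing sequence has `sup_k ‖f_k‖ → 0`, so an extremizing one with a vanishing subsequence would
force the best constant to be 0. That is impossible since the extension operator is injective
(`IsExtension.ae_eq_zero`). -/

noncomputable section

namespace Hyperboloid

/-! ### Bipolar coordinates in `ℝ³` -/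

/-- Polar coordinates for a radial function in the plane. -/
theorem lintegral_prod_sq_add_sq (g : ℝ → ℝ≥0∞) (hg : Measurable g) :
    ∫⁻ w : ℝ × ℝ, g (w.1 ^ 2 + w.2 ^ 2) = ENNReal.ofReal Real.pi * ∫⁻ r in Set.Ioi 0, g r := by
  have himg : (fun r : ℝ => r ^ 2) '' Set.Ioi 0 = Set.Ioi 0 := by
    ext x
    constructor
    · rintro ⟨r, hr, rfl⟩
      exact pow_pos (Set.mem_Ioi.1 hr) 2
    · intro hx
      exact ⟨√x, Real.sqrt_pos.2 hx, Real.sq_sqrt (Set.mem_Ioi.1 hx).le⟩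
  have hsub : ∫⁻ r in Set.Ioi (0 : ℝ), g r
      = ∫⁻ r in Set.Ioi (0 : ℝ), ENNReal.ofReal |2 * r| * g (r ^ 2) := by
    conv_lhs => rw [← himg]
    refine lintegral_image_eq_lintegral_abs_deriv_mul measurableSet_Ioi (fun x _ => ?_) ?_ g
    · simpa using (hasDerivAt_pow 2 x).hasDerivWithinAt
    · intro a ha b hb hab
      exact (pow_left_inj₀ (Set.mem_Ioi.1 ha).le (Set.mem_Ioi.1 hb).le two_ne_zero).1 hab
  rw [← lintegral_comp_polarCoord_symm, polarCoord_target, Measure.volume_eq_prod,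
    ← Measure.prod_restrict]
  have hpt : ∀ p : ℝ × ℝ, ENNReal.ofReal p.1 • g ((polarCoord.symm p).1 ^ 2
      + (polarCoord.symm p).2 ^ 2) = ENNReal.ofReal p.1 * g (p.1 ^ 2) := fun p => by
    rw [polarCoord_symm_apply, smul_eq_mul]
    congr 2
    linear_combination p.1 ^ 2 * Real.cos_sq_add_sin_sq p.2
  simp_rw [hpt]
  rw [lintegral_prod _ (by fun_prop), hsub, ← lintegral_const_mul _ (by fun_prop)]
  refine setLIntegral_congr_fun measurableSet_Ioi fun r hr => ?_
  have hr0 : (0 : ℝ) < r := hr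
  dsimp only
  rw [setLIntegral_const, Real.volume_Ioo, abs_of_pos (by linarith), ← mul_assoc,
    ← ENNReal.ofReal_mul Real.pi_pos.le, mul_right_comm, ← ENNReal.ofReal_mul hr0.le]
  congr 2
  ring

/-- A radial integral in two of the three coordinates. -/
theorem lintegral_euclidean_three (G : ℝ → ℝ → ℝ≥0∞) (hG : Measurable (Function.uncurry G)) :
    ∫⁻ y : R3, G (y 0) (‖y‖ ^ 2) =
      ENNReal.ofReal Real.pi * ∫⁻ p : ℝ, ∫⁻ r in Set.Ioi 0, G p (p ^ 2 + r) := by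
  have h1 := (PiLp.volume_preserving_toLp (Fin 3)).lintegral_comp_emb
    (MeasurableEquiv.toLp 2 (Fin 3 → ℝ)).measurableEmbedding (fun y : R3 => G (y 0) (‖y‖ ^ 2))
  have h2 := (volume_preserving_piFinSuccAbove (fun _ : Fin 3 => ℝ) 0).symm.lintegral_comp_emb
    (MeasurableEquiv.measurableEmbedding _)
    (fun y : Fin 3 → ℝ => G (y 0) (y 0 ^ 2 + (y 1 ^ 2 + y 2 ^ 2)))
  have h3 : ∀ p : ℝ, _ := fun p => (volume_preserving_finTwoArrow ℝ).lintegral_comp_emb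
    (MeasurableEquiv.measurableEmbedding _)
    (fun w : ℝ × ℝ => G p (p ^ 2 + (w.1 ^ 2 + w.2 ^ 2)))
  rw [← h1]
  simp only [EuclideanSpace.norm_sq_eq, Fin.sum_univ_three, Real.norm_eq_abs, sq_abs, add_assoc]
  rw [h2.symm, Measure.volume_eq_prod]
  have h4 : ∀ (p : ℝ) (w : Fin 2 → ℝ), (MeasurableEquiv.piFinSuccAbove (fun _ : Fin 3 => ℝ) 0).symm
      (p, w) = Fin.cons p w := fun p w => by
    simp [MeasurableEquiv.piFinSuccAbove, Fin.insertNthEquiv]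
  rw [lintegral_prod _ (by fun_prop), ← lintegral_const_mul _ ?_]
  · refine lintegral_congr fun p => ?_
    rw [← lintegral_prod_sq_add_sq (fun r => G p (p ^ 2 + r)) (by fun_prop), ← h3]
    refine lintegral_congr fun w => ?_
    rw [h4]
    rfl
  · fun_prop

/-- Bipolar coordinates with foci 0 and `x`. With `p` the coordinate along `x` and `r` the squared
distance to that axis, Lebesgue measure becomes `π dp dr`, and `(p, r) ↦ (|y|², |x - y|²)` is a
shear-type map with Jacobian `2|x|`. Only an inequality results because the constraint `r > 0` is
discarded. -/
theorem lintegral_norm_sq_norm_sub_sq (H : ℝ × ℝ → ℝ≥0∞) (hH : Measurable H) {x : R3}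
    (hx : x ≠ 0) :
    ∫⁻ y : R3, H (‖y‖ ^ 2, ‖x - y‖ ^ 2) ≤
      ENNReal.ofReal (Real.pi / (2 * ‖x‖)) * ∫⁻ a, ∫⁻ b, H (a, b) := by
  set t := ‖x‖ with ht
  have ht0 : 0 < t := norm_pos_iff.2 hx
  set e : R3 := EuclideanSpace.single 0 1 with he
  have hnorm : ‖x‖ = ‖t • e‖ := by simp [norm_smul, he, ht]
  -- A reflection carries `x` to the first coordinate axis; it preserves norms and volume.
  set ρ : R3 ≃ₗᵢ[ℝ] R3 := Submodule.reflection (ℝ ∙ (x - t • e))ᗮ with hρ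
  have hρx : ρ x = t • e := Submodule.reflection_sub hnorm
  have h1 := ρ.measurePreserving.lintegral_comp_emb ρ.toMeasurableEquiv.measurableEmbedding
    (fun y => H (‖y‖ ^ 2, ‖t • e - y‖ ^ 2))
  have h2 : ∀ y, ‖t • e - ρ y‖ = ‖x - y‖ := fun y => by
    rw [← hρx, ← map_sub, ρ.norm_map]
  simp only [h2, ρ.norm_map] at h1
  have h3 : ∀ y : R3, ‖t • e - y‖ ^ 2 = t ^ 2 - 2 * t * y 0 + ‖y‖ ^ 2 := fun y => by
    rw [norm_sub_sq_real, norm_smul, inner_smul_left, he]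
    simp [EuclideanSpace.inner_single_left]
    ring
  simp only [h3] at h1
  rw [h1, lintegral_euclidean_three (fun p q => H (q, t ^ 2 - 2 * t * p + q)) (by fun_prop)]
  have h4 : ∀ p : ℝ, ∫⁻ r in Set.Ioi 0, H (p ^ 2 + r, t ^ 2 - 2 * t * p + (p ^ 2 + r)) ≤
      ∫⁻ a, H (a, t ^ 2 - 2 * t * p + a) := fun p => by
    refine (setLIntegral_le_lintegral _ _).trans ?_
    rw [lintegral_add_left_eq_self (μ := volume) (fun a => H (a, t ^ 2 - 2 * t * p + a)) (p ^ 2)]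
  -- For fixed `a`, the second variable is affine in `p` with slope `-2t`.
  have h5 : ∀ a : ℝ, ∫⁻ p : ℝ, H (a, t ^ 2 - 2 * t * p + a) =
      ENNReal.ofReal (1 / (2 * t)) * ∫⁻ b, H (a, b) := fun a => by
    have hm := lintegral_map (μ := volume) (f := fun b => H (a, t ^ 2 + a + b))
      (g := fun p : ℝ => (-(2 * t)) * p) (by fun_prop) (by fun_prop)
    rw [Real.map_volume_mul_left (by linarith), lintegral_smul_measure,
      lintegral_add_left_eq_self (μ := volume) (fun b => H (a, b))] at hm
    rw [abs_inv, abs_neg, abs_of_pos (by linarith)] at hm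
    rw [one_div]
    refine Eq.trans ?_ (hm.symm.trans (smul_eq_mul _ _))
    refine lintegral_congr fun p => ?_
    congr 2
    ring
  calc _ ≤ ENNReal.ofReal Real.pi * ∫⁻ p : ℝ, ∫⁻ a, H (a, t ^ 2 - 2 * t * p + a) := by
        exact mul_le_mul_right (lintegral_mono h4) _
    _ = ENNReal.ofReal Real.pi * ∫⁻ a, ∫⁻ p : ℝ, H (a, t ^ 2 - 2 * t * p + a) := by
        rw [lintegral_lintegral_swap (by fun_prop)]
    _ = ENNReal.ofReal Real.pi * (ENNReal.ofReal (1 / (2 * t)) * ∫⁻ a, ∫⁻ b, H (a, b)) := by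
        simp_rw [h5]
        rw [lintegral_const_mul _ (by fun_prop)]
    _ ≤ _ := by
        rw [← mul_assoc, ← ENNReal.ofReal_mul Real.pi_pos.le, mul_one_div]

/-! ### The convolution of two dyadic pieces of `μ` -/

/-- The density of `μ` in terms of `a = |y|²`. -/
def radialWeight : ℝ → ℝ≥0∞ :=
  (Set.Ioi 1).indicator fun a => ENNReal.ofReal (1 / √(a - 1))

@[fun_prop]
theorem measurable_radialWeight : Measurable radialWeight :=
  Measurable.indicator (by fun_prop) measurableSet_Ioi

theorem lintegral_mu_eq (g : R4 → ℝ≥0∞) (hg : Measurable g) :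
    ∫⁻ ξ, g ξ ∂mu = ∫⁻ y : R3, radialWeight (‖y‖ ^ 2) * g (lift y) := by
  rw [lintegral_mu g hg, ← lintegral_indicator (measurableSet_lt (by fun_prop) (by fun_prop))]
  refine lintegral_congr fun y => ?_
  by_cases hy : 1 < ‖y‖
  · have : 1 < ‖y‖ ^ 2 := one_lt_pow₀ hy two_ne_zero
    simp [radialWeight, hy, this, lift]
  · have : ¬ 1 < ‖y‖ ^ 2 := not_lt.2 (pow_le_one₀ (norm_nonneg _) (not_lt.1 hy))
    simp [radialWeight, hy, this]

/-- Under `a = 1 + s²` the factor `da = 2s ds` cancels the weight `1 / s`, including its singularity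
at `a = 1`. -/
theorem lintegral_radialWeight_mul (g : ℝ → ℝ≥0∞) :
    ∫⁻ a, radialWeight a * g (√(a - 1)) = 2 * ∫⁻ s in Set.Ioi 0, g s := by
  have himg : (fun s : ℝ => 1 + s ^ 2) '' Set.Ioi 0 = Set.Ioi 1 := by
    ext x
    constructor
    · rintro ⟨r, hr, rfl⟩
      simpa using pow_pos (Set.mem_Ioi.1 hr) 2
    · intro hx
      have : 0 < x - 1 := sub_pos.2 hx
      exact ⟨√(x - 1), Real.sqrt_pos.2 this, by simp [Real.sq_sqrt this.le]⟩
  have h1 : ∫⁻ a, radialWeight a * g (√(a - 1)) =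
      ∫⁻ a in Set.Ioi 1, ENNReal.ofReal (1 / √(a - 1)) * g (√(a - 1)) := by
    rw [← lintegral_indicator measurableSet_Ioi]
    refine lintegral_congr fun a => ?_
    by_cases ha : a ∈ Set.Ioi (1 : ℝ) <;> simp [radialWeight, ha]
  rw [h1, ← himg, lintegral_image_eq_lintegral_abs_deriv_mul (f' := fun s => 2 * s)
    measurableSet_Ioi, ← lintegral_const_mul' _ _ (by simp)]
  · refine setLIntegral_congr_fun measurableSet_Ioi fun s hs => ?_
    have hs0 : (0 : ℝ) < s := hs
    rw [add_sub_cancel_left, Real.sqrt_sq hs0.le, ← mul_assoc, ← ENNReal.ofReal_mul (abs_nonneg _),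
      abs_of_pos (by linarith), mul_assoc, mul_one_div_cancel hs0.ne', mul_one]
    norm_num
  · exact fun x _ => by simpa using ((hasDerivAt_pow 2 x).const_add 1).hasDerivWithinAt
  · intro a ha b hb hab
    exact (pow_left_inj₀ (Set.mem_Ioi.1 ha).le (Set.mem_Ioi.1 hb).le two_ne_zero).1
      (add_left_cancel hab)

theorem lintegral_radialWeight_indicator_le (c : ℝ) :
    ∫⁻ a, radialWeight a * (Set.Iio c).indicator 1 (√(a - 1)) ≤ 2 * ENNReal.ofReal c := by
  rw [lintegral_radialWeight_mul, ← lintegral_indicator measurableSet_Ioi]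
  have : ∀ s : ℝ, (Set.Ioi 0).indicator (fun s => (Set.Iio c).indicator 1 s) s ≤
      (Set.Ioo 0 c).indicator (1 : ℝ → ℝ≥0∞) s := fun s => by
    by_cases h1 : 0 < s <;> by_cases h2 : s < c <;> simp [h1, h2]
  refine mul_le_mul_right ((lintegral_mono this).trans ?_) _
  rw [lintegral_indicator_one measurableSet_Ioo]
  simp

/-- The dyadic annulus `{2^k ≤ |y| < 2^(k+1)}`. -/
def annulus (k : ℕ) : Set R4 := {ξ : R4 | (2 : ℝ) ^ k ≤ ‖ξ.fst‖ ∧ ‖ξ.fst‖ < (2 : ℝ) ^ (k + 1)}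

theorem continuous_fst : Continuous fun ξ : R4 => ξ.fst := by fun_prop

theorem measurableSet_annulus (k : ℕ) : MeasurableSet (annulus k) := by
  have : Measurable fun ξ : R4 => ‖ξ.fst‖ := continuous_fst.norm.measurable
  exact (measurableSet_le measurable_const this).inter (measurableSet_lt this measurable_const)

theorem sqrt_sub_one_lt {k : ℕ} {y : R3} (hy : lift y ∈ annulus k) :
    √(‖y‖ ^ 2 - 1) < 2 ^ (k + 1) := by
  have h2 : ‖y‖ < 2 ^ (k + 1) := hy.2
  rw [Real.sqrt_lt' (by positivity)]
  have := pow_lt_pow_left₀ h2 (norm_nonneg y) two_ne_zero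
  linarith

/-- A crude bound, as the true size is of order `4^k`; finiteness and polynomial growth are all that
is needed. It reuses the bipolar estimate with an auxiliary unit vector `e` as second focus. -/
theorem mu_annulus_le (k : ℕ) : mu (annulus k) ≤ ENNReal.ofReal (32 * Real.pi * 8 ^ k) := by
  set e : R3 := EuclideanSpace.single 0 1 with he
  have hne : ‖e‖ = 1 := by simp [he]
  have he0 : e ≠ 0 := norm_ne_zero_iff.1 (by rw [hne]; exact one_ne_zero)
  set c : ℝ := 2 ^ (k + 1) with hc
  have hc0 : 0 < c := by positivity
  have hc2 : 2 ≤ c := by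
    rw [hc, pow_succ]; linarith [one_le_pow₀ (M₀ := ℝ) one_le_two (n := k)]
  -- The cutoff in the second variable holds automatically on the annulus, as `|e - y| ≤ 1 + c ≤
  -- 2c`; it makes the integral in `b` finite.
  set H : ℝ × ℝ → ℝ≥0∞ := fun p => (radialWeight p.1 * (Set.Iio c).indicator 1 (√(p.1 - 1))) *
    (Set.Icc 0 ((2 * c) ^ 2)).indicator 1 p.2 with hH
  have hi1 : Measurable ((Set.Iio c).indicator (1 : ℝ → ℝ≥0∞)) :=
    measurable_one.indicator measurableSet_Iio
  have hi2 : Measurable ((Set.Icc 0 ((2 * c) ^ 2)).indicator (1 : ℝ → ℝ≥0∞)) :=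
    measurable_one.indicator measurableSet_Icc
  have hHm : Measurable H := by fun_prop
  rw [← lintegral_indicator_one (measurableSet_annulus k),
    lintegral_mu_eq _ (measurable_one.indicator (measurableSet_annulus k))]
  calc _ ≤ ∫⁻ y : R3, H (‖y‖ ^ 2, ‖e - y‖ ^ 2) := by
        refine lintegral_mono fun y => ?_
        by_cases hy : lift y ∈ annulus k
        · have h1 := sqrt_sub_one_lt hy
          have h2 : ‖y‖ < c := hy.2
          have h3 : ‖e - y‖ ≤ 2 * c := (norm_sub_le _ _).trans (by rw [hne]; linarith)
          have h4 : ‖e - y‖ ^ 2 ≤ (2 * c) ^ 2 := pow_le_pow_left₀ (norm_nonneg _) h3 2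
          simp only [hH]
          rw [Set.indicator_of_mem hy, Set.indicator_of_mem (by exact h1),
            Set.indicator_of_mem (Set.mem_Icc.2 ⟨by positivity, h4⟩)]
          simp
        · simp [hy]
    _ ≤ ENNReal.ofReal (Real.pi / (2 * ‖e‖)) * ∫⁻ a, ∫⁻ b, H (a, b) :=
        lintegral_norm_sq_norm_sub_sq H hHm he0
    _ ≤ ENNReal.ofReal (Real.pi / 2) * ((2 * ENNReal.ofReal c) * ENNReal.ofReal ((2 * c) ^ 2)) := by
        rw [hne, mul_one]
        refine mul_le_mul_right ?_ _
        simp only [hH]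
        have : ∀ a : ℝ, ∫⁻ b, radialWeight a * (Set.Iio c).indicator 1 (√(a - 1)) *
            (Set.Icc 0 ((2 * c) ^ 2)).indicator 1 b =
            radialWeight a * (Set.Iio c).indicator 1 (√(a - 1)) * ENNReal.ofReal ((2 * c) ^ 2) :=
          fun a => by
            rw [lintegral_const_mul _ hi2, lintegral_indicator_one measurableSet_Icc]
            simp
        simp_rw [this]
        rw [lintegral_mul_const _ (by fun_prop)]
        exact mul_le_mul_left (lintegral_radialWeight_indicator_le c) _
    _ = _ := by
        rw [show (2 : ℝ≥0∞) = ENNReal.ofReal 2 by simp, ← ENNReal.ofReal_mul zero_le_two,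
          ← ENNReal.ofReal_mul (by positivity), ← ENNReal.ofReal_mul (by positivity)]
        congr 1
        rw [hc, show (8 : ℝ) = 2 ^ 3 by norm_num, ← pow_mul]
        ring

theorem lintegral_R4 (Φ : R4 → ℝ≥0∞) (hΦ : Measurable Φ) :
    ∫⁻ z, Φ z = ∫⁻ x : R3, ∫⁻ τ : ℝ, Φ (WithLp.toLp 2 (x, τ)) := by
  rw [← (WithLp.volume_preserving_toLp (U := R3) (V := ℝ)).lintegral_comp hΦ,
    Measure.volume_eq_prod, lintegral_prod _ (by fun_prop)]

/-- The convolution of two dyadic pieces of `μ` over sets with nonnegative inner products is bounded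
by a multiple of Lebesgue measure which decays in the ratio of the scales. -/
theorem setLIntegral_add_le_of_le {A B : Set R4} (hAm : MeasurableSet A) (hBm : MeasurableSet B)
    {k l : ℕ} (hA : A ⊆ annulus k) (hB : B ⊆ annulus l)
    (hAB : ∀ ξ ∈ A, ∀ η ∈ B, (0 : ℝ) ≤ inner ℝ ξ.fst η.fst)
    (Φ : R4 → ℝ≥0∞) (hΦ : Measurable Φ) :
    ∫⁻ ξ in A, ∫⁻ η in B, Φ (ξ + η) ∂mu ∂mu ≤
      ENNReal.ofReal (4 * Real.pi * 2 ^ k / 2 ^ l) * ∫⁻ z, Φ z := by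
  have hl := measurable_lift
  set IA : R4 → ℝ≥0∞ := A.indicator 1 with hIA
  set IB : R4 → ℝ≥0∞ := B.indicator 1 with hIB
  have hIAm : Measurable IA := measurable_one.indicator hAm
  have hIBm : Measurable IB := measurable_one.indicator hBm
  set P : R3 → R3 → ℝ≥0∞ := fun y y' => radialWeight (‖y‖ ^ 2) * (IA (lift y) *
    (radialWeight (‖y'‖ ^ 2) * (IB (lift y') * Φ (lift y + lift y')))) with hP
  have hPm : Measurable (Function.uncurry P) := by
    simp only [hP]
    fun_prop
  have hset : ∀ (S : Set R4) (_ : MeasurableSet S) (g : R4 → ℝ≥0∞), Measurable g →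
      ∫⁻ ξ in S, g ξ ∂mu = ∫⁻ y : R3, radialWeight (‖y‖ ^ 2) *
        (S.indicator 1 (lift y) * g (lift y)) := fun S hS g hg => by
    rw [← lintegral_indicator hS, lintegral_mu_eq _ (hg.indicator hS)]
    refine lintegral_congr fun y => ?_
    by_cases h : lift y ∈ S <;> simp [h]
  have hmu : SFinite mu := by unfold mu; infer_instance
  -- Change of variables `x = y + y'`, with `x` as the outer variable.
  have h1 : ∫⁻ ξ in A, ∫⁻ η in B, Φ (ξ + η) ∂mu ∂mu = ∫⁻ x : R3, ∫⁻ y : R3, P y (x - y) := by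
    rw [hset A hAm _ (Measurable.lintegral_prod_right' (ν := mu.restrict B)
      (f := fun p : R4 × R4 => Φ (p.1 + p.2)) (by fun_prop)),
      lintegral_lintegral_swap (by fun_prop)]
    refine lintegral_congr fun y => ?_
    rw [lintegral_sub_right_eq_self (μ := volume) (P y) y]
    rw [hset B hBm _ (by fun_prop)]
    simp only [hP]
    rw [lintegral_const_mul _ (by fun_prop), lintegral_const_mul _ (by fun_prop)]
  rw [h1, lintegral_R4 Φ hΦ, ← lintegral_const_mul _ (by fun_prop)]
  refine lintegral_mono fun x => ?_
  dsimp only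
  set c : ℝ := 2 ^ (k + 1) with hc
  set M := ∫⁻ τ : ℝ, Φ (WithLp.toLp 2 (x, τ)) with hM
  -- Nonnegative inner products give `|x|² ≥ |y|² + |x - y|² ≥ 4^l` wherever the integrand is
  -- nonzero, so small `x` contribute nothing.
  by_cases hx : 2 ^ l ≤ ‖x‖
  swap
  · have : ∀ y, P y (x - y) = 0 := fun y => by
      by_cases hyA : lift y ∈ A
      · by_cases hyB : lift (x - y) ∈ B
        · refine absurd ?_ hx
          have h2 : (0 : ℝ) ≤ inner ℝ y (x - y) := hAB _ hyA _ hyB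
          have h3 : (2 : ℝ) ^ l ≤ ‖x - y‖ := (hB hyB).1
          have h4 : ‖x‖ ^ 2 = ‖y‖ ^ 2 + 2 * inner ℝ y (x - y) + ‖x - y‖ ^ 2 := by
            rw [← norm_add_sq_real, add_sub_cancel]
          refine h3.trans (le_of_sq_le_sq ?_ (norm_nonneg _))
          nlinarith [sq_nonneg ‖y‖]
        · simp [hP, hIB, hyB]
      · simp [hP, hIA, hyA]
    simp [this]
  have hl0 : (0 : ℝ) < 2 ^ l := by positivity
  have hx0 : x ≠ 0 := norm_pos_iff.1 (hl0.trans_le hx)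
  set H : ℝ × ℝ → ℝ≥0∞ := fun p => (radialWeight p.1 * (Set.Iio c).indicator 1 (√(p.1 - 1))) *
    (radialWeight p.2 * Φ (WithLp.toLp 2 (x, √(p.1 - 1) + √(p.2 - 1)))) with hH
  have hi1 : Measurable ((Set.Iio c).indicator (1 : ℝ → ℝ≥0∞)) :=
    measurable_one.indicator measurableSet_Iio
  have hHm : Measurable H := by fun_prop
  calc ∫⁻ y : R3, P y (x - y) ≤ ∫⁻ y : R3, H (‖y‖ ^ 2, ‖x - y‖ ^ 2) := by
        refine lintegral_mono fun y => ?_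
        by_cases hyA : lift y ∈ A
        · by_cases hyB : lift (x - y) ∈ B
          · have h1 := sqrt_sub_one_lt (hA hyA)
            have h2 : lift y + lift (x - y) =
                WithLp.toLp 2 (x, √(‖y‖ ^ 2 - 1) + √(‖x - y‖ ^ 2 - 1)) := by
              rw [lift, lift, ← WithLp.toLp_add, Prod.mk_add_mk, add_sub_cancel]
            simp only [hH, hP]
            rw [h2, hIA, hIB, Set.indicator_of_mem hyA, Set.indicator_of_mem hyB,
              Set.indicator_of_mem (by exact h1)]
            simp
          · simp [hP, hIB, hyB]
        · simp [hP, hIA, hyA]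
    _ ≤ ENNReal.ofReal (Real.pi / (2 * ‖x‖)) * ∫⁻ a, ∫⁻ b, H (a, b) :=
        lintegral_norm_sq_norm_sub_sq H hHm hx0
    -- The `b` integral becomes `2 ds` over a translate of a half line, hence at most `2M`; the `a`
    -- integral contributes `2c` with `c = 2^(k+1)`.
    _ ≤ ENNReal.ofReal (Real.pi / (2 * 2 ^ l)) * ((2 * ENNReal.ofReal c) * (2 * M)) := by
        gcongr
        have : ∀ a : ℝ, ∫⁻ b, H (a, b) ≤
            radialWeight a * (Set.Iio c).indicator 1 (√(a - 1)) * (2 * M) := fun a => by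
          simp only [hH]
          rw [lintegral_const_mul _ (by fun_prop),
            lintegral_radialWeight_mul (fun s => Φ (WithLp.toLp 2 (x, √(a - 1) + s)))]
          gcongr
          refine (setLIntegral_le_lintegral _ _).trans_eq ?_
          exact lintegral_add_left_eq_self (μ := volume) (fun s => Φ (WithLp.toLp 2 (x, s))) _
        refine (lintegral_mono this).trans ?_
        rw [lintegral_mul_const _ (by fun_prop)]
        exact mul_le_mul_left (lintegral_radialWeight_indicator_le c) _
    _ = _ := by
        rw [show (2 : ℝ≥0∞) = ENNReal.ofReal 2 by simp, ← ENNReal.ofReal_mul zero_le_two,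
          ← mul_assoc, ← mul_assoc, ← ENNReal.ofReal_mul (by positivity),
          ← ENNReal.ofReal_mul (by positivity)]
        congr 2
        rw [hc]
        field_simp
        ring

theorem setLIntegral_add_le {A B : Set R4} (hAm : MeasurableSet A) (hBm : MeasurableSet B)
    {k l : ℕ} (hA : A ⊆ annulus k) (hB : B ⊆ annulus l)
    (hAB : ∀ ξ ∈ A, ∀ η ∈ B, (0 : ℝ) ≤ inner ℝ ξ.fst η.fst)
    (Φ : R4 → ℝ≥0∞) (hΦ : Measurable Φ) :
    ∫⁻ ξ in A, ∫⁻ η in B, Φ (ξ + η) ∂mu ∂mu ≤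
      ENNReal.ofReal (4 * Real.pi) * 2⁻¹ ^ ((k : ℤ) - l).natAbs * ∫⁻ z, Φ z := by
  have key : ∀ {k l : ℕ}, k ≤ l → ENNReal.ofReal (4 * Real.pi * 2 ^ k / 2 ^ l) =
      ENNReal.ofReal (4 * Real.pi) * 2⁻¹ ^ ((k : ℤ) - l).natAbs := fun {k l} h => by
    obtain ⟨d, rfl⟩ := Nat.exists_eq_add_of_le h
    rw [show ((k : ℤ) - (k + d : ℕ)).natAbs = d by omega, mul_div_assoc,
      ENNReal.ofReal_mul (by positivity), pow_add, div_mul_cancel_left₀ (by positivity), ← inv_pow,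
      ENNReal.ofReal_pow (by positivity), ENNReal.ofReal_inv_of_pos two_pos, ENNReal.ofReal_ofNat]
  rcases le_total k l with h | h
  · rw [← key h]
    exact setLIntegral_add_le_of_le hAm hBm hA hB hAB Φ hΦ
  · have hmu : SFinite mu := by unfold mu; infer_instance
    rw [show ((k : ℤ) - l).natAbs = ((l : ℤ) - k).natAbs by omega, ← key h,
      lintegral_lintegral_swap (by fun_prop)]
    simp_rw [add_comm _ (_ : R4)]
    refine (le_of_eq ?_).trans (setLIntegral_add_le_of_le hBm hAm hB hA
      (fun ξ hξ η hη => by rw [real_inner_comm]; exact hAB η hη ξ hξ) Φ hΦ)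
    rfl

/-! ### The Fourier transform and duality -/

/-- The function `z ↦ ∫ e^{i z · ξ} f(ξ) dν(ξ)`. -/
def extInt (ν : Measure R4) (f : R4 → ℂ) (z : R4) : ℂ :=
  ∫ ξ, Complex.exp (Complex.I * (inner ℝ z ξ : ℝ)) * f ξ ∂ν

theorem norm_exp_I_mul (t : ℝ) : ‖Complex.exp (Complex.I * t)‖ = 1 := by
  rw [mul_comm, Complex.norm_exp_ofReal_mul_I]

theorem continuous_extInt {ν : Measure R4} {f : R4 → ℂ} (hf : Integrable f ν) :
    Continuous (extInt ν f) := by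
  refine continuous_of_dominated (bound := fun ξ => ‖f ξ‖) (fun z => ?_) (fun z => ?_) hf.norm ?_
  · exact (by fun_prop : Continuous fun ξ : R4 =>
      Complex.exp (Complex.I * (inner ℝ z ξ : ℝ))).aestronglyMeasurable.mul hf.1
  · exact ae_of_all _ fun ξ => by rw [norm_mul, norm_exp_I_mul, one_mul]
  · exact ae_of_all _ fun ξ => by fun_prop

theorem norm_extInt_le {ν : Measure R4} {f : R4 → ℂ} (z : R4) :
    ‖extInt ν f z‖ ≤ ∫ ξ, ‖f ξ‖ ∂ν := by
  refine (norm_integral_le_integral_norm _).trans_eq ?_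
  simp_rw [norm_mul, norm_exp_I_mul, one_mul]

/-- The dilation by `1 / (2 π)`. -/
def dilation : R4 ≃L[ℝ] R4 :=
  ContinuousLinearEquiv.smulLeft (Units.mk0 (2 * Real.pi)⁻¹ (by positivity))

theorem dilation_apply (ξ : R4) : dilation ξ = (2 * Real.pi)⁻¹ • ξ := rfl

/-- The Fourier transform `ξ ↦ ∫ e^{i z · ξ} φ(z) dz` on Schwartz functions. -/
def hat (φ : 𝓢(R4, ℂ)) : 𝓢(R4, ℂ) :=
  SchwartzMap.compCLMOfContinuousLinearEquiv ℂ dilation (FourierTransform.fourierInv φ)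

theorem hat_apply (φ : 𝓢(R4, ℂ)) (ξ : R4) :
    hat φ ξ = ∫ z, Complex.exp (Complex.I * (inner ℝ z ξ : ℝ)) * φ z := by
  rw [hat, SchwartzMap.compCLMOfContinuousLinearEquiv_apply, Function.comp_apply, dilation_apply,
    SchwartzMap.fourierInv_coe, Real.fourierInv_eq']
  refine integral_congr_ae (ae_of_all _ fun z => ?_)
  simp only [smul_eq_mul, inner_smul_right]
  congr 2
  rw [mul_comm Complex.I]
  congr 2
  field_simp

/-- Makes every Schwartz function on the frequency side available as a test function, as the
injectivity of the extension operator requires. -/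
theorem hat_surjective : Function.Surjective hat := fun φ => by
  refine ⟨FourierTransform.fourier
    (SchwartzMap.compCLMOfContinuousLinearEquiv ℂ dilation.symm φ), ?_⟩
  ext ξ
  simp [hat]

/-- Plancherel; `(2π)^4` is the Jacobian of the dilation relating `e^{i z · ξ}` to the normalization
`e^{2πi z · ξ}` in dimension four. -/
theorem lintegral_hat_sq (φ : 𝓢(R4, ℂ)) :
    ∫⁻ ξ, ‖hat φ ξ‖ₑ ^ 2 = ENNReal.ofReal ((2 * Real.pi) ^ 4) * ∫⁻ z, ‖φ z‖ₑ ^ 2 := by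
  have h1 : ∀ ψ : 𝓢(R4, ℂ), ∫⁻ z, ‖ψ z‖ₑ ^ 2 = ENNReal.ofReal (∫ z, ‖ψ z‖ ^ 2) := fun ψ => by
    rw [ofReal_integral_eq_lintegral_ofReal _ (ae_of_all _ fun z => by positivity)]
    · refine lintegral_congr fun z => ?_
      rw [ENNReal.ofReal_pow (norm_nonneg _), ofReal_norm]
    · exact (ψ.memLp 2).integrable_norm_pow two_ne_zero
  have h2 : ∫ ξ, ‖hat φ ξ‖ ^ 2 =
      (2 * Real.pi) ^ 4 * ∫ ξ, ‖(FourierTransform.fourierInv φ : 𝓢(R4, ℂ)) ξ‖ ^ 2 := by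
    have := Measure.integral_comp_inv_smul (volume : Measure R4)
      (fun ξ => ‖(FourierTransform.fourierInv φ : 𝓢(R4, ℂ)) ξ‖ ^ 2) (2 * Real.pi)
    rw [show Module.finrank ℝ R4 = 4 by
      rw [(WithLp.linearEquiv 2 ℝ (R3 × ℝ)).finrank_eq, Module.finrank_prod]; simp] at this
    rw [abs_of_pos (by positivity)] at this
    exact this
  have h3 := SchwartzMap.integral_norm_sq_fourier (FourierTransform.fourierInv φ : 𝓢(R4, ℂ))
  rw [FourierTransform.fourier_fourierInv_eq] at h3
  rw [h1, h1, h2, h3, ENNReal.ofReal_mul (by positivity)]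

/-- A continuous function that acts boundedly in `L²` on Schwartz functions lies in `L²`. -/
theorem lintegral_sq_le_of_forall_schwartz {u : R4 → ℂ} (hu : Continuous u) {M : ℝ≥0}
    (h : ∀ φ : 𝓢(R4, ℂ), ‖∫ z, u z * φ z‖ₑ ^ 2 ≤ M * ∫⁻ z, ‖φ z‖ₑ ^ 2)
    (hint : ∀ φ : 𝓢(R4, ℂ), Integrable (fun z => u z * φ z)) :
    ∫⁻ z, ‖u z‖ₑ ^ 2 ≤ M := by
  set e : 𝓢(R4, ℂ) →ₗ[ℂ] Lp ℂ 2 (volume : Measure R4) :=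
    (SchwartzMap.toLpCLM ℂ ℂ 2 (volume : Measure R4)).toLinearMap with he
  have hdense : DenseRange e := SchwartzMap.denseRange_toLpCLM ENNReal.ofNat_ne_top
  let L : 𝓢(R4, ℂ) →ₗ[ℂ] ℂ :=
    { toFun := fun φ => ∫ z, u z * φ z
      map_add' := fun φ ψ => by
        rw [← integral_add (hint φ) (hint ψ)]
        simp [mul_add]
      map_smul' := fun c φ => by
        rw [RingHom.id_apply, smul_eq_mul, ← integral_const_mul]
        refine integral_congr_ae (ae_of_all _ fun z => ?_)
        simp
        ring }
  have hnorm_sq : ∀ v : Lp ℂ 2 (volume : Measure R4), ‖v‖ₑ ^ 2 = ∫⁻ z, ‖v z‖ₑ ^ 2 := fun v => by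
    rw [Lp.enorm_def, eLpNorm_eq_lintegral_rpow_enorm_toReal two_ne_zero ENNReal.ofNat_ne_top]
    rw [← ENNReal.rpow_natCast, ← ENNReal.rpow_mul]
    norm_num
  have hbd : ∀ φ, ‖L φ‖ ≤ √M * ‖e φ‖ := fun φ => by
    have h1 := h φ
    have h2 : ∫⁻ z, ‖φ z‖ₑ ^ 2 = ‖e φ‖ₑ ^ 2 := by
      rw [hnorm_sq]
      refine lintegral_congr_ae ?_
      filter_upwards [φ.coeFn_toLp 2 volume] with z hz
      rw [← hz]
      rfl
    rw [h2] at h1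
    have h3 : ‖L φ‖₊ ^ 2 ≤ M * ‖e φ‖₊ ^ 2 := by
      have : ((‖L φ‖₊ ^ 2 : ℝ≥0) : ℝ≥0∞) ≤ ((M * ‖e φ‖₊ ^ 2 : ℝ≥0) : ℝ≥0∞) := by
        push_cast
        exact h1
      exact_mod_cast this
    have h4 : ‖L φ‖ ^ 2 ≤ M * ‖e φ‖ ^ 2 := by exact_mod_cast h3
    refine le_of_sq_le_sq ?_ (by positivity)
    rw [mul_pow, Real.sq_sqrt M.coe_nonneg]
    exact h4
  -- The functional extends from the dense Schwartz functions to `L²`; its Riesz representative `w`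
  -- has norm at most `√M`, and `u` agrees with the conjugate of `w` almost everywhere.
  set T := L.extendOfNorm e with hT
  have hTb := LinearMap.norm_extendOfNorm_apply_le hdense _ hbd
  set w := (InnerProductSpace.toDual ℂ (Lp ℂ 2 (volume : Measure R4))).symm T with hw
  have hwn : ‖w‖ ≤ √M := by
    rw [hw, LinearIsometryEquiv.norm_map]
    exact T.opNorm_le_bound (by positivity) hTb
  have hLw : ∀ φ : 𝓢(R4, ℂ), ∫ z, u z * φ z = ∫ z, (starRingEnd ℂ) (w z) * φ z := fun φ => by
    have h1 : L φ = inner ℂ w (e φ) := by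
      rw [hw, InnerProductSpace.toDual_symm_apply, hT,
        LinearMap.extendOfNorm_eq hdense ⟨_, hbd⟩]
    rw [L2.inner_def] at h1
    refine Eq.trans h1 (integral_congr_ae ?_)
    filter_upwards [φ.coeFn_toLp 2 volume] with z hz
    have : (e φ) z = φ z := hz
    rw [this, RCLike.inner_apply, mul_comm]
  have hws : MemLp (fun z => (starRingEnd ℂ) (w z)) 2 (volume : Measure R4) := (Lp.memLp w).star
  have hae : ∀ᵐ z ∂(volume : Measure R4), u z = (starRingEnd ℂ) (w z) := by
    refine ae_eq_of_integral_contDiff_smul_eq hu.locallyIntegrable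
      (hws.locallyIntegrable (by norm_num)) fun g hg hc => ?_
    have hc' : HasCompactSupport (fun z => (g z : ℂ)) :=
      hc.comp_left (g := fun x : ℝ => (x : ℂ)) (by simp)
    have hg' : ContDiff ℝ (⊤ : ℕ∞) (fun z => (g z : ℂ)) := Complex.ofRealCLM.contDiff.comp hg
    simpa [mul_comm] using hLw (hc'.toSchwartzMap hg')
  calc ∫⁻ z, ‖u z‖ₑ ^ 2 = ‖w‖ₑ ^ 2 := by
        rw [hnorm_sq]
        refine lintegral_congr_ae ?_
        filter_upwards [hae] with z hz
        rw [hz, ← ofReal_norm, RCLike.norm_conj, ofReal_norm]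
    _ ≤ M := by
        have h1 : ‖w‖ ^ 2 ≤ (M : ℝ) :=
          (pow_le_pow_left₀ (norm_nonneg _) hwn 2).trans_eq (Real.sq_sqrt M.coe_nonneg)
        have h2 : ‖w‖₊ ^ 2 ≤ M := by exact_mod_cast h1
        rw [enorm_eq_nnnorm]
        exact_mod_cast h2

/-- The bilinear extension estimate: if the convolution of two measures is bounded by `K` times
Lebesgue measure, then the product of the extensions lies in `L²`. -/
theorem lintegral_extInt_mul_extInt_le {μ ν : Measure R4} [SFinite μ] [SFinite ν] {K : ℝ≥0∞}
    (hK : K ≠ ∞)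
    (hconv : ∀ Φ : R4 → ℝ≥0∞, Measurable Φ →
      ∫⁻ ξ, ∫⁻ η, Φ (ξ + η) ∂ν ∂μ ≤ K * ∫⁻ z, Φ z)
    {f g : R4 → ℂ} (hf : Integrable f μ) (hg : Integrable g ν) (hf2 : MemLp f 2 μ)
    (hg2 : MemLp g 2 ν) :
    ∫⁻ z, ‖extInt μ f z‖ₑ ^ 2 * ‖extInt ν g z‖ₑ ^ 2 ≤
      ENNReal.ofReal ((2 * Real.pi) ^ 4) * K *
        ((∫⁻ ξ, ‖f ξ‖ₑ ^ 2 ∂μ) * ∫⁻ η, ‖g η‖ₑ ^ 2 ∂ν) := by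
  have hfin : ∀ {ρ : Measure R4} {f : R4 → ℂ}, MemLp f 2 ρ → ∫⁻ ξ, ‖f ξ‖ₑ ^ 2 ∂ρ ≠ ∞ :=
    fun {ρ f} hf => by
      have := lintegral_rpow_enorm_lt_top_of_eLpNorm_lt_top two_ne_zero ENNReal.ofNat_ne_top hf.2
      simpa using this.ne
  set M := ENNReal.ofReal ((2 * Real.pi) ^ 4) * K *
        ((∫⁻ ξ, ‖f ξ‖ₑ ^ 2 ∂μ) * ∫⁻ η, ‖g η‖ₑ ^ 2 ∂ν) with hM
  have hMfin : M ≠ ∞ := ENNReal.mul_ne_top (ENNReal.mul_ne_top ENNReal.ofReal_ne_top hK)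
    (ENNReal.mul_ne_top (hfin hf2) (hfin hg2))
  have hc1 := continuous_extInt hf
  have hc2 := continuous_extInt hg
  have hint : ∀ φ : 𝓢(R4, ℂ), Integrable (fun z => extInt μ f z * extInt ν g z * φ z) :=
    fun φ => by
      refine φ.integrable.bdd_mul (c := (∫ ξ, ‖f ξ‖ ∂μ) * ∫ ξ, ‖g ξ‖ ∂ν)
        (hc1.mul hc2).aestronglyMeasurable (ae_of_all _ fun z => ?_)
      rw [norm_mul]
      exact mul_le_mul (norm_extInt_le z) (norm_extInt_le z) (norm_nonneg _)
        (integral_nonneg fun _ => norm_nonneg _)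
  have key := lintegral_sq_le_of_forall_schwartz (hc1.mul hc2) (M := M.toNNReal) (fun φ => ?_)
    hint
  · simpa [mul_pow, ENNReal.coe_toNNReal hMfin] using key
  rw [ENNReal.coe_toNNReal hMfin]
  have hfg : Integrable (fun p : R4 × R4 => f p.1 * g p.2) (μ.prod ν) := hf.mul_prod hg
  -- The two phases multiply to `e^{i z · (ξ + η)}`, so integrating in `z` first leaves `hat φ (ξ +
  -- η)`.
  have hfubini : ∫ z, extInt μ f z * extInt ν g z * φ z =
      ∫ p : R4 × R4, f p.1 * g p.2 * hat φ (p.1 + p.2) ∂(μ.prod ν) := by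
    have h1 : ∀ z, extInt μ f z * extInt ν g z * φ z = ∫ p : R4 × R4,
        Complex.exp (Complex.I * (inner ℝ z (p.1 + p.2) : ℝ)) * φ z * (f p.1 * g p.2)
          ∂(μ.prod ν) := fun z => by
      rw [extInt, extInt, ← integral_prod_mul, ← integral_mul_const]
      refine integral_congr_ae (ae_of_all _ fun p => ?_)
      simp only [inner_add_right, Complex.ofReal_add, mul_add, Complex.exp_add]
      ring
    simp_rw [h1]
    rw [integral_integral_swap]
    · refine integral_congr_ae (ae_of_all _ fun p => ?_)
      simp only
      rw [integral_mul_const, hat_apply, mul_comm]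
    · have h0 := (φ.integrable (μ := volume)).mul_prod hfg
      refine (h0.bdd_mul (c := 1) (f := fun q : R4 × R4 × R4 =>
        Complex.exp (Complex.I * (inner ℝ q.1 (q.2.1 + q.2.2) : ℝ))) (by fun_prop)
        (ae_of_all _ fun q => (norm_exp_I_mul _).le)).congr (ae_of_all _ fun q => ?_)
      simp [Function.uncurry]
      ring
  have hhm : Measurable fun p : R4 × R4 => ‖hat φ (p.1 + p.2)‖ₑ :=
    ((hat φ).continuous.comp (by fun_prop : Continuous fun p : R4 × R4 => p.1 + p.2)).measurable.enorm
  have hfgm : AEMeasurable (fun p : R4 × R4 => ‖f p.1 * g p.2‖ₑ) (μ.prod ν) := hfg.1.enorm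
  -- One factor is the tensor product norm of `f` and `g`; the other is `|hat φ|²` integrated
  -- against the convolution, controlled by `hconv` and Plancherel.
  have hCS := ENNReal.lintegral_mul_le_Lp_mul_Lq (μ.prod ν) Real.HolderConjugate.two_two hfgm
    hhm.aemeasurable
  have h2 : ∫⁻ p : R4 × R4, ‖f p.1 * g p.2‖ₑ ^ (2 : ℝ) ∂(μ.prod ν) =
      (∫⁻ ξ, ‖f ξ‖ₑ ^ 2 ∂μ) * ∫⁻ η, ‖g η‖ₑ ^ 2 ∂ν := by
    rw [← lintegral_prod_mul (hf.1.enorm.pow_const 2) (hg.1.enorm.pow_const 2)]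
    refine lintegral_congr fun p => ?_
    rw [enorm_mul, ENNReal.rpow_ofNat, mul_pow]
  have h3 : ∫⁻ p : R4 × R4, ‖hat φ (p.1 + p.2)‖ₑ ^ (2 : ℝ) ∂(μ.prod ν) ≤
      K * (ENNReal.ofReal ((2 * Real.pi) ^ 4) * ∫⁻ z, ‖φ z‖ₑ ^ 2) := by
    rw [← lintegral_hat_sq, lintegral_prod _ (hhm.pow_const _).aemeasurable]
    simp_rw [ENNReal.rpow_ofNat]
    exact hconv (fun z => ‖hat φ z‖ₑ ^ 2) ((hat φ).continuous.measurable.enorm.pow_const 2)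
  calc ‖∫ z, extInt μ f z * extInt ν g z * φ z‖ₑ ^ 2
      ≤ (∫⁻ p : R4 × R4, ‖f p.1 * g p.2‖ₑ * ‖hat φ (p.1 + p.2)‖ₑ ∂(μ.prod ν)) ^ 2 := by
        rw [hfubini]
        gcongr
        refine (enorm_integral_le_lintegral_enorm _).trans_eq ?_
        simp_rw [enorm_mul]
    _ ≤ _ := pow_le_pow_left₀ zero_le hCS 2
    _ ≤ ((∫⁻ ξ, ‖f ξ‖ₑ ^ 2 ∂μ) * ∫⁻ η, ‖g η‖ₑ ^ 2 ∂ν) *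
        (K * (ENNReal.ofReal ((2 * Real.pi) ^ 4) * ∫⁻ z, ‖φ z‖ₑ ^ 2)) := by
        rw [mul_pow, ← ENNReal.rpow_natCast, ← ENNReal.rpow_natCast, ← ENNReal.rpow_mul,
          ← ENNReal.rpow_mul]
        norm_num
        rw [← h2]
        gcongr
        · simp_rw [ENNReal.rpow_ofNat]
          simp
        · simpa using h3
    _ = M * ∫⁻ z, ‖φ z‖ₑ ^ 2 := by
        rw [hM]
        ring

/-! ### Summation of almost orthogonal quadrilinear pieces -/

section Summation

variable {α : Type*} [MeasurableSpace α] {ρ : Measure α}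

theorem tsum_pow_natAbs_ne_top {b : ℝ≥0∞} (hb : b < 1) : ∑' n : ℤ, b ^ n.natAbs ≠ ∞ := by
  have h1 : ∑' n : ℕ, b ^ n ≠ ∞ := by
    rw [ENNReal.tsum_geometric]
    exact ENNReal.inv_ne_top.2 (tsub_pos_of_lt hb).ne'
  have h2 : ∑' n : ℤ, b ^ n.natAbs ≤ ∑' n : ℕ, b ^ n + ∑' n : ℕ, b ^ n := by
    rw [tsum_of_nat_of_neg_add_one ENNReal.summable ENNReal.summable]
    refine add_le_add (by simp) (ENNReal.tsum_le_tsum fun n => ?_)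
    exact pow_le_pow_right_of_le_one' hb.le (by omega)
  exact ne_top_of_le_ne_top (ENNReal.add_ne_top.2 ⟨h1, h1⟩) h2

theorem tsum_pow_natAbs_sub_le (b : ℝ≥0∞) (k : ℕ) :
    ∑' l : ℕ, b ^ ((k : ℤ) - l).natAbs ≤ ∑' n : ℤ, b ^ n.natAbs :=
  ENNReal.tsum_comp_le_tsum_of_injective (f := fun l : ℕ => (k : ℤ) - l)
    (fun i j h => by simpa using h) (fun n : ℤ => b ^ n.natAbs)

theorem tsum_pow_natAbs_sub_le' (b : ℝ≥0∞) (l : ℕ) :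
    ∑' k : ℕ, b ^ ((k : ℤ) - l).natAbs ≤ ∑' n : ℤ, b ^ n.natAbs :=
  ENNReal.tsum_comp_le_tsum_of_injective (f := fun k : ℕ => (k : ℤ) - l)
    (fun i j h => by simpa using h) (fun n : ℤ => b ^ n.natAbs)

theorem mul_mul_mul_le_sum_pow_four (a b c d : ℝ≥0∞) :
    a * b * c * d ≤ a ^ 4 + b ^ 4 + c ^ 4 + d ^ 4 := by
  have h : ∀ m, a ≤ m → b ≤ m → c ≤ m → d ≤ m → a * b * c * d ≤ m ^ 4 := fun m ha hb hc hd => by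
    calc a * b * c * d ≤ m * m * m * m := by gcongr
      _ = m ^ 4 := by ring
  have hm : max (max a b) (max c d) = a ∨ max (max a b) (max c d) = b ∨
      max (max a b) (max c d) = c ∨ max (max a b) (max c d) = d := by
    rcases max_choice (max a b) (max c d) with h | h <;> rw [h]
    · rcases max_choice a b with h | h <;> simp [h]
    · rcases max_choice c d with h | h <;> simp [h]
  refine (h (max (max a b) (max c d)) (by simp) (by simp) (by simp) (by simp)).trans ?_
  rcases hm with h | h | h | h <;> rw [h]
  · rw [add_assoc, add_assoc]; exact le_self_add
  · rw [add_assoc, add_assoc, add_left_comm]; exact le_self_add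
  · rw [add_right_comm]; exact le_add_self
  · exact le_add_self

/-- Cauchy--Schwarz for a product of four functions. -/
theorem lintegral_mul_four_sq_le {p q r s : α → ℝ≥0∞} (hp : Measurable p) (hq : Measurable q)
    (hr : Measurable r) (hs : Measurable s) :
    (∫⁻ z, p z * q z * r z * s z ∂ρ) ^ 2 ≤
      (∫⁻ z, p z ^ 2 * q z ^ 2 ∂ρ) * ∫⁻ z, r z ^ 2 * s z ^ 2 ∂ρ := by
  have h := ENNReal.lintegral_mul_le_Lp_mul_Lq ρ Real.HolderConjugate.two_two
    (hp.mul hq).aemeasurable (hr.mul hs).aemeasurable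
  have h2 := pow_le_pow_left₀ zero_le h 2
  rw [mul_pow, ← ENNReal.rpow_natCast (_ ^ (1 / 2 : ℝ)), ← ENNReal.rpow_natCast (_ ^ (1 / 2 : ℝ)),
    ← ENNReal.rpow_mul, ← ENNReal.rpow_mul] at h2
  norm_num [mul_pow] at h2
  simpa [mul_assoc] using h2

/-- If the products `G k * G l` of nonnegative functions decay geometrically in `|k - l|` in `L²`,
then the fourth power of the `L⁴` norm of the sum is bounded by the sum of the fourth powers. -/
theorem lintegral_tsum_pow_four_le {G : ℕ → α → ℝ≥0∞} (hG : ∀ k, Measurable (G k))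
    {a : ℕ → ℝ≥0∞} {b K : ℝ≥0∞} (hb : b ≤ 1)
    (h : ∀ k l, ∫⁻ z, G k z ^ 2 * G l z ^ 2 ∂ρ ≤
      (K * b ^ (3 * ((k : ℤ) - l).natAbs) * (a k * a l)) ^ 2) :
    ∫⁻ z, (∑' k, G k z) ^ 4 ∂ρ ≤
      4 * K ^ 2 * (∑' n : ℤ, b ^ n.natAbs) ^ 3 * ∑' k, a k ^ 4 := by
  set R := ∑' n : ℤ, b ^ n.natAbs with hR
  set δ : ℕ → ℕ → ℕ := fun k l => ((k : ℤ) - l).natAbs with hδ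
  have hpair : ∀ k l m n, ∫⁻ z, G k z * G l z * G m z * G n z ∂ρ ≤
      K ^ 2 * b ^ (3 * (δ k l + δ m n)) * (a k * a l * a m * a n) := fun k l m n => by
    rw [← ENNReal.pow_le_pow_left_iff two_ne_zero]
    refine (lintegral_mul_four_sq_le (hG k) (hG l) (hG m) (hG n)).trans
      ((mul_le_mul' (h k l) (h m n)).trans_eq ?_)
    ring
  have hall : ∀ k l m n, ∫⁻ z, G k z * G l z * G m z * G n z ∂ρ ≤
      K ^ 2 * b ^ (δ k l + δ k m + δ k n) * (a k ^ 4 + a l ^ 4 + a m ^ 4 + a n ^ 4) :=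
    fun k l m n => by
    -- Pair `k` with the index farthest from it. The bilinear decay then has exponent at least three
    -- times the largest distance, which dominates the sum of all three. This is why the hypothesis
    -- carries the factor 3.
    have h1 : ∃ N, δ k l + δ k m + δ k n ≤ N ∧ ∫⁻ z, G k z * G l z * G m z * G n z ∂ρ ≤
        K ^ 2 * b ^ N * (a k * a l * a m * a n) := by
      rcases le_total (δ k l) (δ k m) with h1 | h1
      · rcases le_total (δ k m) (δ k n) with h2 | h2
        · refine ⟨3 * (δ k n + δ m l), by omega, ?_⟩
          convert hpair k n m l using 1
          · exact lintegral_congr fun z => by ring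
          · ring
        · refine ⟨3 * (δ k m + δ l n), by omega, ?_⟩
          convert hpair k m l n using 1
          · exact lintegral_congr fun z => by ring
          · ring
      · rcases le_total (δ k l) (δ k n) with h2 | h2
        · refine ⟨3 * (δ k n + δ m l), by omega, ?_⟩
          convert hpair k n m l using 1
          · exact lintegral_congr fun z => by ring
          · ring
        · exact ⟨3 * (δ k l + δ m n), by omega, hpair k l m n⟩
    obtain ⟨N, hN, h2⟩ := h1
    refine h2.trans ?_
    exact mul_le_mul' (mul_le_mul' le_rfl (pow_le_pow_right_of_le_one' hb hN))
      (mul_mul_mul_le_sum_pow_four _ _ _ _)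
  have hexp : ∀ z, (∑' k, G k z) ^ 4 =
      ∑' k, ∑' l, ∑' m, ∑' n, G k z * G l z * G m z * G n z := fun z => by
    simp only [ENNReal.tsum_mul_left, ENNReal.tsum_mul_right]
    ring
  have hint : ∫⁻ z, (∑' k, G k z) ^ 4 ∂ρ =
      ∑' k, ∑' l, ∑' m, ∑' n, ∫⁻ z, G k z * G l z * G m z * G n z ∂ρ := by
    simp_rw [hexp]
    rw [lintegral_tsum fun k => by fun_prop]
    refine tsum_congr fun k => ?_
    rw [lintegral_tsum fun l => by fun_prop]
    refine tsum_congr fun l => ?_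
    rw [lintegral_tsum fun m => by fun_prop]
    refine tsum_congr fun m => ?_
    rw [lintegral_tsum fun n => by fun_prop]
  have hrow : ∀ k, ∑' l, b ^ δ k l ≤ R := tsum_pow_natAbs_sub_le b
  -- Schur's test: the column sums of `b ^ δ k l` are bounded by `R`, like the row sums.
  have hconv : ∑' k, ∑' l, b ^ δ k l * a l ^ 4 ≤ R * ∑' l, a l ^ 4 := by
    rw [ENNReal.tsum_comm, ← ENNReal.tsum_mul_left]
    refine ENNReal.tsum_le_tsum fun l => ?_
    rw [ENNReal.tsum_mul_right]
    exact mul_le_mul_left (tsum_pow_natAbs_sub_le' b l) _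
  set S := ∑' l, a l ^ 4 with hS
  rw [hint]
  have hk : ∀ k, ∑' l, ∑' m, ∑' n, ∫⁻ z, G k z * G l z * G m z * G n z ∂ρ ≤
      K ^ 2 * (R ^ 3 * a k ^ 4 + 3 * (R ^ 2 * ∑' l, b ^ δ k l * a l ^ 4)) := fun k => by
    set w : ℕ → ℝ≥0∞ := fun l => b ^ δ k l with hw
    have e1 : ∀ l m n, K ^ 2 * b ^ (δ k l + δ k m + δ k n) *
        (a k ^ 4 + a l ^ 4 + a m ^ 4 + a n ^ 4) =
        K ^ 2 * (a k ^ 4 * (w l * (w m * w n)) + (w l * a l ^ 4) * (w m * w n) +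
          w l * ((w m * a m ^ 4) * w n) + w l * (w m * (w n * a n ^ 4))) := fun l m n => by
      simp only [hw, pow_add]
      ring
    calc _ ≤ ∑' l, ∑' m, ∑' n, K ^ 2 * b ^ (δ k l + δ k m + δ k n) *
        (a k ^ 4 + a l ^ 4 + a m ^ 4 + a n ^ 4) :=
          ENNReal.tsum_le_tsum fun l => ENNReal.tsum_le_tsum fun m =>
            ENNReal.tsum_le_tsum fun n => hall k l m n
      _ = K ^ 2 * (a k ^ 4 * ((∑' l, w l) * ((∑' l, w l) * ∑' l, w l)) +
          3 * ((∑' l, w l * a l ^ 4) * ((∑' l, w l) * ∑' l, w l))) := by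
          simp only [e1, ENNReal.tsum_mul_left, ENNReal.tsum_add, ENNReal.tsum_mul_right]
          ring
      _ ≤ K ^ 2 * (a k ^ 4 * (R * (R * R)) + 3 * ((∑' l, w l * a l ^ 4) * (R * R))) := by
          gcongr <;> exact hrow k
      _ = _ := by ring
  calc _ ≤ ∑' k, K ^ 2 * (R ^ 3 * a k ^ 4 + 3 * (R ^ 2 * ∑' l, b ^ δ k l * a l ^ 4)) :=
        ENNReal.tsum_le_tsum hk
    _ = K ^ 2 * (R ^ 3 * S + 3 * (R ^ 2 * ∑' k, ∑' l, b ^ δ k l * a l ^ 4)) := by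
        simp_rw [ENNReal.tsum_mul_left, ENNReal.tsum_add, ENNReal.tsum_mul_left]
        rw [hS]
    _ ≤ K ^ 2 * (R ^ 3 * S + 3 * (R ^ 2 * (R * S))) := by gcongr
    _ = _ := by ring

end Summation

/-! ### The extension operator of the upper half of the hyperboloid -/

instance : SFinite mu := by unfold mu; infer_instance

theorem eLpNorm_two_sq {α : Type*} [MeasurableSpace α] (f : α → ℂ) (ρ : Measure α) :
    eLpNorm f 2 ρ ^ 2 = ∫⁻ ξ, ‖f ξ‖ₑ ^ 2 ∂ρ := by
  rw [eLpNorm_eq_lintegral_rpow_enorm_toReal two_ne_zero ENNReal.ofNat_ne_top,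
    ← ENNReal.rpow_natCast, ← ENNReal.rpow_mul]
  norm_num

theorem eLpNorm_four_le {α : Type*} [MeasurableSpace α] {ρ : Measure α} {F : α → ℂ}
    {D : α → ℝ≥0∞} (h : ∀ z, ‖F z‖ₑ ≤ D z) :
    eLpNorm F 4 ρ ≤ (∫⁻ z, D z ^ 4 ∂ρ) ^ (1 / 4 : ℝ) := by
  rw [eLpNorm_eq_lintegral_rpow_enorm_toReal (by norm_num) ENNReal.ofNat_ne_top]
  simp only [ENNReal.toReal_ofNat, ENNReal.rpow_ofNat]
  gcongr with z
  exact h z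

theorem eLpNorm_dyadicPiece (f : R4 → ℂ) (k : ℕ) (ν : Measure R4) :
    eLpNorm (dyadicPiece f k) 2 ν = eLpNorm f 2 (ν.restrict (annulus k)) :=
  eLpNorm_indicator_eq_eLpNorm_restrict (measurableSet_annulus k)

theorem pairwise_disjoint_annulus : Pairwise (Function.onFun Disjoint annulus) := by
  have key : ∀ {k l : ℕ} {ξ : R4}, ξ ∈ annulus k → ξ ∈ annulus l → k ≤ l := fun {k l ξ} hk hl =>
    Nat.lt_succ_iff.1 ((pow_lt_pow_iff_right₀ (one_lt_two (α := ℝ))).1 (hk.1.trans_lt hl.2))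
  intro k l hkl
  exact Set.disjoint_left.2 fun ξ hk hl => hkl (le_antisymm (key hk hl) (key hl hk))

theorem mem_iUnion_annulus {ξ : R4} (h : 1 ≤ ‖ξ.fst‖) : ξ ∈ ⋃ k, annulus k :=
  Set.mem_iUnion.2 (exists_nat_pow_near h one_lt_two)

theorem ae_mem_iUnion_annulus : ∀ᵐ ξ ∂mu, ξ ∈ ⋃ k, annulus k := by
  have hm : MeasurableSet (⋃ k, annulus k) := MeasurableSet.iUnion measurableSet_annulus
  refine (ae_map_iff (p := fun ξ => ξ ∈ ⋃ k, annulus k) measurable_lift.aemeasurable hm).2 ?_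
  refine (withDensity_absolutelyContinuous _ _).ae_le ?_
  filter_upwards [ae_restrict_mem (measurableSet_lt measurable_const measurable_norm)] with y hy
  exact mem_iUnion_annulus (le_of_lt hy)

theorem mu_annulus_lt_top (k : ℕ) : mu (annulus k) < ∞ :=
  (mu_annulus_le k).trans_lt ENNReal.ofReal_lt_top

/-- On the annulus of index `k` the weight is at most `16^(-k)` and the mass is `O(8^k)`, so the
pieces sum geometrically. The resulting temperate growth puts Schwartz functions in `L²(μ)`. -/
theorem integrable_one_add_norm_mu : Integrable (fun ξ : R4 => (1 + ‖ξ‖) ^ (-((4 : ℕ) : ℝ))) mu := by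
  have hc : Continuous fun ξ : R4 => (1 + ‖ξ‖) ^ (-((4 : ℕ) : ℝ)) :=
    Continuous.rpow_const (by fun_prop) fun ξ => Or.inl (by positivity)
  refine ⟨hc.aestronglyMeasurable, ?_⟩
  have h1 : ∫⁻ ξ, ‖(1 + ‖ξ‖) ^ (-((4 : ℕ) : ℝ))‖ₑ ∂mu ≤
      ∑' k : ℕ, ENNReal.ofReal (32 * Real.pi) * 2⁻¹ ^ k := by
    rw [← Measure.restrict_eq_self_of_ae_mem ae_mem_iUnion_annulus]
    refine (lintegral_iUnion_le _ _).trans (ENNReal.tsum_le_tsum fun k => ?_)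
    have h2 : ∀ ξ ∈ annulus k, ‖(1 + ‖ξ‖) ^ (-((4 : ℕ) : ℝ))‖ₑ ≤ ENNReal.ofReal ((16 ^ k)⁻¹) :=
      fun ξ hξ => by
        rw [← ofReal_norm, Real.norm_of_nonneg (by positivity)]
        refine ENNReal.ofReal_le_ofReal ?_
        rw [Real.rpow_neg (by positivity), Real.rpow_natCast]
        refine inv_anti₀ (by positivity) ?_
        rw [show (16 : ℝ) = 2 ^ 4 by norm_num, ← pow_mul, mul_comm, pow_mul]
        refine pow_le_pow_left₀ (by positivity) ?_ 4
        have := WithLp.prod_norm_sq_eq_of_L2 ξ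
        have h3 : ‖ξ.fst‖ ≤ ‖ξ‖ := le_of_sq_le_sq (by rw [this]; simp; positivity) (norm_nonneg _)
        linarith [hξ.1]
    refine (setLIntegral_mono_ae' (measurableSet_annulus k) (ae_of_all _ h2)).trans ?_
    rw [setLIntegral_const]
    refine (mul_le_mul_right (mu_annulus_le k) _).trans_eq ?_
    rw [← ENNReal.ofReal_mul (by positivity), show (2⁻¹ : ℝ≥0∞) = ENNReal.ofReal 2⁻¹ by
      rw [ENNReal.ofReal_inv_of_pos two_pos, ENNReal.ofReal_ofNat], ← ENNReal.ofReal_pow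
      (by positivity), ← ENNReal.ofReal_mul (by positivity)]
    congr 1
    rw [show (16 : ℝ) = 8 * 2 by norm_num, mul_pow, inv_pow]
    field_simp
  refine h1.trans_lt ?_
  rw [ENNReal.tsum_mul_left, ENNReal.tsum_geometric]
  refine ENNReal.mul_lt_top ENNReal.ofReal_lt_top (ENNReal.inv_lt_top.2 ?_)
  simp

instance : mu.HasTemperateGrowth := ⟨⟨4, integrable_one_add_norm_mu⟩⟩

/-- The octants of `ℝ³`. -/
def octant (σ : Fin 3 → Bool) : Set R4 := {ξ : R4 | ∀ i, 0 ≤ ξ.fst i ↔ σ i = true}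

theorem measurableSet_octant (σ : Fin 3 → Bool) : MeasurableSet (octant σ) := by
  have h : ∀ i, MeasurableSet {ξ : R4 | 0 ≤ ξ.fst i} := fun i =>
    measurableSet_le measurable_const (by fun_prop : Continuous fun ξ : R4 => ξ.fst i).measurable
  have h' : octant σ = ⋂ i, if σ i = true then {ξ : R4 | 0 ≤ ξ.fst i} else {ξ | 0 ≤ ξ.fst i}ᶜ := by
    ext ξ
    rw [Set.mem_iInter]
    refine forall_congr' fun i => ?_
    by_cases hi : σ i = true <;> simp [hi]
  rw [h']
  refine MeasurableSet.iInter fun i => ?_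
  split_ifs
  exacts [h i, (h i).compl]

/-- The reason for using octants: matching coordinates share a sign, so each term of the inner
product is nonnegative. -/
theorem inner_nonneg_of_mem_octant {σ : Fin 3 → Bool} {ξ η : R4} (hξ : ξ ∈ octant σ)
    (hη : η ∈ octant σ) : (0 : ℝ) ≤ inner ℝ ξ.fst η.fst := by
  rw [PiLp.inner_apply]
  refine Finset.sum_nonneg fun i _ => ?_
  rw [RCLike.inner_apply, conj_trivial]
  have h1 := hξ i
  have h2 := hη i
  by_cases h : σ i = true
  · exact mul_nonneg (h2.2 h) (h1.2 h)
  · exact mul_nonneg_of_nonpos_of_nonpos (not_le.1 (mt h2.1 h)).le (not_le.1 (mt h1.1 h)).le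

theorem pairwise_disjoint_octant : Pairwise (Function.onFun Disjoint octant) := by
  intro σ τ hστ
  refine Set.disjoint_left.2 fun ξ h1 h2 => hστ (funext fun i => ?_)
  exact Bool.eq_iff_iff.2 ((h1 i).symm.trans (h2 i))

theorem iUnion_octant : ⋃ σ, octant σ = Set.univ :=
  Set.eq_univ_of_forall fun ξ => Set.mem_iUnion.2 ⟨fun i => decide (0 ≤ ξ.fst i), fun i => by simp⟩

theorem lintegral_tsum_extInt_pow_four_le : ∃ C : ℝ≥0, ∀ (σ : Fin 3 → Bool) (f : R4 → ℂ),
    MemLp f 2 mu →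
      ∫⁻ z, (∑' k, ‖extInt (mu.restrict (annulus k ∩ octant σ)) f z‖ₑ) ^ 4 ≤
        C * ∑' k, eLpNorm (dyadicPiece f k) 2 mu ^ 4 := by
  -- The convolution gains `2^(-|k-l|)` for the squared `L²` norm, which the summation lemma expects
  -- as `(b ^ (3|k-l|))²`; hence `b ^ 6 = 1/2`.
  set b : ℝ≥0∞ := 2⁻¹ ^ (1 / 6 : ℝ) with hb
  have hb1 : b < 1 := ENNReal.rpow_lt_one (by simp) (by norm_num)
  have hb6 : b ^ 6 = 2⁻¹ := by
    rw [hb, ← ENNReal.rpow_natCast, ← ENNReal.rpow_mul]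
    norm_num
  set L : ℝ≥0∞ := ENNReal.ofReal ((2 * Real.pi) ^ 4) * ENNReal.ofReal (4 * Real.pi) with hL
  have hLfin : L ≠ ∞ := ENNReal.mul_ne_top ENNReal.ofReal_ne_top ENNReal.ofReal_ne_top
  set K : ℝ≥0∞ := L ^ (1 / 2 : ℝ) with hK
  have hK2 : K ^ 2 = L := by
    rw [hK, ← ENNReal.rpow_natCast, ← ENNReal.rpow_mul]
    norm_num
  set c := 4 * L * (∑' n : ℤ, b ^ n.natAbs) ^ 3 with hc
  have hcfin : c ≠ ∞ := ENNReal.mul_ne_top (ENNReal.mul_ne_top (by norm_num) hLfin)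
    (ENNReal.pow_ne_top (tsum_pow_natAbs_ne_top hb1))
  refine ⟨c.toNNReal, fun σ f hf => ?_⟩
  rw [ENNReal.coe_toNNReal hcfin]
  have hm : ∀ k, MeasurableSet (annulus k ∩ octant σ) := fun k =>
    (measurableSet_annulus k).inter (measurableSet_octant σ)
  have hfin : ∀ k, IsFiniteMeasure (mu.restrict (annulus k ∩ octant σ)) := fun k =>
    ⟨by
      rw [Measure.restrict_apply_univ]
      exact (measure_mono Set.inter_subset_left).trans_lt (mu_annulus_lt_top k)⟩
  have hf2 : ∀ k, MemLp f 2 (mu.restrict (annulus k ∩ octant σ)) := fun k => hf.restrict _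
  have hf1 : ∀ k, Integrable f (mu.restrict (annulus k ∩ octant σ)) := fun k =>
    (hf2 k).integrable one_le_two
  have key := lintegral_tsum_pow_four_le (ρ := (volume : Measure R4)) (b := b) (K := K)
    (G := fun k z => ‖extInt (mu.restrict (annulus k ∩ octant σ)) f z‖ₑ)
    (a := fun k => eLpNorm f 2 (mu.restrict (annulus k ∩ octant σ)))
    (fun k => (continuous_extInt (hf1 k)).measurable.enorm) hb1.le fun k l => by
      refine (lintegral_extInt_mul_extInt_le
        (K := ENNReal.ofReal (4 * Real.pi) * 2⁻¹ ^ ((k : ℤ) - l).natAbs)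
        (ENNReal.mul_ne_top ENNReal.ofReal_ne_top (ENNReal.pow_ne_top (by simp)))
        (fun Φ hΦ => setLIntegral_add_le (hm k) (hm l) Set.inter_subset_left Set.inter_subset_left
          (fun ξ hξ η hη => inner_nonneg_of_mem_octant hξ.2 hη.2) Φ hΦ)
        (hf1 k) (hf1 l) (hf2 k) (hf2 l)).trans_eq ?_
      rw [← eLpNorm_two_sq, ← eLpNorm_two_sq, ← hb6, mul_pow (K * _), mul_pow K, hK2, hL]
      ring
  refine key.trans ?_
  rw [hK2]
  gcongr with k
  rw [eLpNorm_dyadicPiece]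
  exact eLpNorm_mono_measure _ (Measure.restrict_mono Set.inter_subset_left le_rfl)

theorem integrable_hat_mul {ν : Measure R4} [ν.HasTemperateGrowth] (φ : 𝓢(R4, ℂ)) {f : R4 → ℂ}
    (hf : MemLp f 2 ν) : Integrable (fun ξ => hat φ ξ * f ξ) ν :=
  ((hat φ).memLp 2 ν).integrable_mul hf

theorem isExtension_iff {ν : Measure R4} {f F : R4 → ℂ} :
    IsExtension ν f F ↔
      MemLp F 4 volume ∧ ∀ φ : 𝓢(R4, ℂ), ∫ z, F z * φ z = ∫ ξ, hat φ ξ * f ξ ∂ν := by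
  simp only [IsExtension, hat_apply]

/-- On each annulus `f` is integrable, so its extension is an honest integral. The `L⁴` bound on the
sum of absolute values makes the series converge almost everywhere and dominates it when tested
against Schwartz functions. -/
theorem exists_isExtension_octant : ∃ C : ℝ≥0, ∀ (σ : Fin 3 → Bool) (f : R4 → ℂ),
    MemLp f 2 mu → ∑' k, eLpNorm (dyadicPiece f k) 2 mu ^ 4 ≠ ∞ →
      ∃ F : R4 → ℂ, IsExtension (mu.restrict (octant σ)) f F ∧
        eLpNorm F 4 volume ≤
          C * (∑' k, eLpNorm (dyadicPiece f k) 2 mu ^ 4) ^ (1 / 4 : ℝ) := by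
  obtain ⟨C, hC⟩ := lintegral_tsum_extInt_pow_four_le
  refine ⟨C ^ (1 / 4 : ℝ), fun σ f hf hfin => ?_⟩
  have hm : ∀ k, MeasurableSet (annulus k ∩ octant σ) := fun k =>
    (measurableSet_annulus k).inter (measurableSet_octant σ)
  have hfinm : ∀ k, IsFiniteMeasure (mu.restrict (annulus k ∩ octant σ)) := fun k =>
    ⟨by
      rw [Measure.restrict_apply_univ]
      exact (measure_mono Set.inter_subset_left).trans_lt (mu_annulus_lt_top k)⟩
  have hf1 : ∀ k, Integrable f (mu.restrict (annulus k ∩ octant σ)) := fun k =>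
    (hf.restrict _).integrable one_le_two
  set E : ℕ → R4 → ℂ := fun k => extInt (mu.restrict (annulus k ∩ octant σ)) f with hE
  have hEc : ∀ k, Continuous (E k) := fun k => continuous_extInt (hf1 k)
  set D : R4 → ℝ≥0∞ := fun z => ∑' k, ‖E k z‖ₑ with hD
  have hDm : Measurable D := Measurable.tsum fun k => (hEc k).measurable.enorm
  have hD4 := hC σ f hf
  have hDfin : ∫⁻ z, D z ^ 4 < ∞ :=
    hD4.trans_lt (ENNReal.mul_lt_top ENNReal.coe_lt_top hfin.lt_top)
  have hDae : ∀ᵐ z, D z < ∞ := by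
    filter_upwards [ae_lt_top (hDm.pow_const 4) hDfin.ne] with z hz
    exact (ENNReal.pow_lt_top_iff).1 hz |>.resolve_right (by norm_num)
  have hsum : ∀ z, D z < ∞ → Summable fun k => E k z := fun z hz =>
    Summable.of_enorm hz.ne
  have hle : ∀ z, ‖∑' k, E k z‖ₑ ≤ D z := fun z => enorm_tsum_le_tsum_enorm
  have hmeas : AEStronglyMeasurable (fun z => ∑' k, E k z) volume := by
    refine aestronglyMeasurable_of_tendsto_ae atTop
      (f := fun n z => ∑ k ∈ Finset.range n, E k z) (fun n => ?_) ?_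
    · exact (continuous_finsetSum _ fun k _ => hEc k).aestronglyMeasurable
    · filter_upwards [hDae] with z hz
      exact (hsum z hz).hasSum.tendsto_sum_nat
  have hbound : eLpNorm (fun z => ∑' k, E k z) 4 volume ≤ (∫⁻ z, D z ^ 4) ^ (1 / 4 : ℝ) :=
    eLpNorm_four_le hle
  have hpow : (∫⁻ z, D z ^ 4) ^ (1 / 4 : ℝ) < ∞ := ENNReal.rpow_lt_top_of_nonneg (by norm_num) hDfin.ne
  refine ⟨fun z => ∑' k, E k z, isExtension_iff.2 ⟨⟨hmeas, hbound.trans_lt hpow⟩, fun φ => ?_⟩, ?_⟩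
  · have hk : ∀ k, ∫ z, E k z * φ z = ∫ ξ in annulus k ∩ octant σ, hat φ ξ * f ξ ∂mu := fun k => by
      have hmem : MemLp (E k) 4 volume := ⟨(hEc k).aestronglyMeasurable,
        (eLpNorm_four_le fun z => ENNReal.le_tsum k).trans_lt hpow⟩
      exact (isExtension_iff.1 (isExtension_integral (hf1 k) hmem)).2 φ
    have hEφ : ∀ k, AEStronglyMeasurable (fun z => E k z * φ z) volume := fun k =>
      ((hEc k).mul φ.continuous).aestronglyMeasurable
    -- Hölder with exponents 4 and 4/3 applied to `D` and `φ`; it justifies exchanging sum and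
    -- integral.
    have hint : ∑' k, ∫⁻ z, ‖E k z * φ z‖ₑ ≠ ∞ := by
      rw [← lintegral_tsum fun k => (hEφ k).enorm]
      simp_rw [enorm_mul, ENNReal.tsum_mul_right]
      have hH : Real.HolderConjugate 4 (4 / 3) := by constructor <;> norm_num
      refine ne_top_of_le_ne_top ?_ (ENNReal.lintegral_mul_le_Lp_mul_Lq volume hH hDm.aemeasurable
        φ.continuous.enorm.aemeasurable)
      refine ENNReal.mul_ne_top ?_ ?_
      · simpa using hpow.ne
      · have hφ := lintegral_rpow_enorm_lt_top_of_eLpNorm_lt_top (p := ENNReal.ofReal (4 / 3))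
          (by norm_num) ENNReal.ofReal_ne_top (φ.memLp (ENNReal.ofReal (4 / 3)) volume).2
        rw [ENNReal.toReal_ofReal (by norm_num)] at hφ
        exact (ENNReal.rpow_lt_top_of_nonneg (by norm_num) hφ.ne).ne
    simp_rw [← tsum_mul_right]
    rw [integral_tsum hEφ hint]
    simp_rw [hk]
    rw [← integral_iUnion hm (fun i j hij => (pairwise_disjoint_annulus hij).mono
      Set.inter_subset_left Set.inter_subset_left) (integrable_hat_mul φ hf).integrableOn,
      ← Set.iUnion_inter]
    refine setIntegral_congr_set ?_
    filter_upwards [ae_mem_iUnion_annulus] with ξ hξ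
    exact propext ⟨fun h => h.2, fun h => ⟨hξ, h⟩⟩
  · refine hbound.trans ((ENNReal.rpow_le_rpow hD4 (by norm_num)).trans_eq ?_)
    rw [ENNReal.mul_rpow_of_nonneg _ _ (by norm_num), ENNReal.coe_rpow_of_nonneg _ (by norm_num)]

/-! ### Reflection, and passage from octants to the half and full hyperboloids -/

theorem IsExtension.neg {f F : R4 → ℂ} {ν : Measure R4}
    (h : IsExtension ν (fun ξ => f (-ξ)) F) :
    IsExtension (ν.map fun ξ => -ξ) f (fun z => F (-z)) := by
  have hneg : MeasurableEmbedding fun ξ : R4 => -ξ := (MeasurableEquiv.neg R4).measurableEmbedding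
  refine ⟨h.1.comp_measurePreserving (Measure.measurePreserving_neg volume), fun φ => ?_⟩
  set φ' : 𝓢(R4, ℂ) :=
    SchwartzMap.compCLMOfContinuousLinearEquiv ℂ (ContinuousLinearEquiv.neg ℝ) φ with hφ'
  have hφ'z : ∀ z, φ' z = φ (-z) := fun z => rfl
  have h2 := h.2 φ'
  rw [hneg.integral_map, ← integral_neg_eq_self]
  simp only [neg_neg]
  simp only [hφ'z] at h2
  rw [h2]
  refine integral_congr_ae (ae_of_all _ fun ξ => ?_)
  dsimp only
  congr 1
  rw [← integral_neg_eq_self]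
  simp only [neg_neg, inner_neg_left, inner_neg_right]

theorem dyadicPiece_comp_neg (f : R4 → ℂ) (k : ℕ) :
    dyadicPiece (fun ξ => f (-ξ)) k = fun ξ => dyadicPiece f k (-ξ) := by
  ext ξ
  simp [dyadicPiece, Set.indicator]

theorem integrable_one_add_norm_map_neg_mu :
    Integrable (fun ξ : R4 => (1 + ‖ξ‖) ^ (-((4 : ℕ) : ℝ))) (mu.map fun ξ => -ξ) := by
  rw [(MeasurableEquiv.neg R4).measurableEmbedding.integrable_map_iff (f := fun ξ : R4 => -ξ)]
  simpa [Function.comp_def] using integrable_one_add_norm_mu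

instance : (mu.map fun ξ => -ξ).HasTemperateGrowth := ⟨⟨4, integrable_one_add_norm_map_neg_mu⟩⟩

instance : muBar.HasTemperateGrowth :=
  ⟨⟨4, integrable_one_add_norm_mu.add_measure integrable_one_add_norm_map_neg_mu⟩⟩

/-- The adjoint restriction inequality `‖T f‖₄⁴ ≤ C ∑ₖ ‖f_k‖₂⁴` with respect to a measure. -/
def DyadicBound (ν : Measure R4) : Prop :=
  ∃ C : ℝ≥0, ∀ f : R4 → ℂ, MemLp f 2 ν → ∑' k, eLpNorm (dyadicPiece f k) 2 ν ^ 4 ≠ ∞ →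
    ∃ F : R4 → ℂ, IsExtension ν f F ∧
      eLpNorm F 4 volume ≤ C * (∑' k, eLpNorm (dyadicPiece f k) 2 ν ^ 4) ^ (1 / 4 : ℝ)

theorem integrable_mul_schwartz {F : R4 → ℂ} (hF : MemLp F 4 volume) (φ : 𝓢(R4, ℂ)) :
    Integrable fun z => F z * φ z := by
  have hH : Real.HolderConjugate 4 (4 / 3) := by constructor <;> norm_num
  have : ENNReal.HolderConjugate 4 (ENNReal.ofReal (4 / 3)) := by
    simpa only [ENNReal.ofReal_ofNat] using hH.ennrealOfReal
  exact hF.integrable_mul (φ.memLp (ENNReal.ofReal (4 / 3)) volume)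

theorem dyadicBound_mu : DyadicBound mu := by
  obtain ⟨C, hC⟩ := exists_isExtension_octant
  -- The triangle inequality over the eight octants.
  refine ⟨8 * C, fun f hf hfin => ?_⟩
  choose F hF hFle using fun σ => hC σ f hf hfin
  refine ⟨fun z => ∑ σ, F σ z, isExtension_iff.2 ⟨memLp_finsetSum _ fun σ _ => (hF σ).1,
    fun φ => ?_⟩, ?_⟩
  · simp_rw [Finset.sum_mul]
    rw [integral_finsetSum _ fun σ _ => integrable_mul_schwartz (hF σ).1 φ]
    simp_rw [fun σ => (isExtension_iff.1 (hF σ)).2 φ]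
    rw [← integral_iUnion_fintype measurableSet_octant pairwise_disjoint_octant
      fun σ => (integrable_hat_mul φ hf).integrableOn, iUnion_octant, Measure.restrict_univ]
  · have h1 : eLpNorm (fun z => ∑ σ, F σ z) 4 volume ≤ ∑ σ, eLpNorm (F σ) 4 volume := by
      have := eLpNorm_sum_le (f := F) (s := Finset.univ) (μ := (volume : Measure R4)) (p := 4)
        (fun σ _ => (hF σ).1.1) (by norm_num)
      rwa [show (∑ σ, F σ) = fun z => ∑ σ, F σ z by ext z; simp] at this
    refine h1.trans ((Finset.sum_le_sum fun σ _ => hFle σ).trans_eq ?_)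
    simp [mul_assoc]

theorem dyadicBound_muBar : DyadicBound muBar := by
  obtain ⟨C, hC⟩ := dyadicBound_mu
  refine ⟨2 * C, fun f hf hfin => ?_⟩
  have hneg : MeasurableEmbedding fun ξ : R4 => -ξ := (MeasurableEquiv.neg R4).measurableEmbedding
  have hle1 : mu ≤ muBar := Measure.le_add_right le_rfl
  have hle2 : mu.map (fun ξ => -ξ) ≤ muBar := Measure.le_add_left le_rfl
  have hf1 : MemLp f 2 mu := hf.mono_measure hle1
  have hf2 : MemLp (fun ξ => f (-ξ)) 2 mu := (hneg.memLp_map_measure_iff).1 (hf.mono_measure hle2)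
  set S := ∑' k, eLpNorm (dyadicPiece f k) 2 muBar ^ 4 with hS
  have hS1 : ∑' k, eLpNorm (dyadicPiece f k) 2 mu ^ 4 ≤ S :=
    ENNReal.tsum_le_tsum fun k => pow_le_pow_left₀ zero_le (eLpNorm_mono_measure _ hle1) 4
  have hS2 : ∑' k, eLpNorm (dyadicPiece (fun ξ => f (-ξ)) k) 2 mu ^ 4 ≤ S :=
    ENNReal.tsum_le_tsum fun k => by
      have h := hneg.eLpNorm_map_measure (g := dyadicPiece f k) (μ := mu) (p := 2)
      rw [dyadicPiece_comp_neg, show (fun ξ => dyadicPiece f k (-ξ)) =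
        dyadicPiece f k ∘ fun ξ => -ξ from rfl, ← h]
      exact pow_le_pow_left₀ zero_le (eLpNorm_mono_measure _ hle2) 4
  obtain ⟨F, hF, hFle⟩ := hC f hf1 (ne_top_of_le_ne_top hfin hS1)
  obtain ⟨G, hG, hGle⟩ := hC _ hf2 (ne_top_of_le_ne_top hfin hS2)
  have hG' := hG.neg
  have hGn : eLpNorm (fun z => G (-z)) 4 volume = eLpNorm G 4 volume :=
    eLpNorm_comp_measurePreserving hG.1.1 (Measure.measurePreserving_neg volume)
  refine ⟨fun z => F z + G (-z), isExtension_iff.2 ⟨hF.1.add hG'.1, fun φ => ?_⟩, ?_⟩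
  · simp_rw [add_mul]
    rw [integral_add (integrable_mul_schwartz hF.1 φ) (integrable_mul_schwartz hG'.1 φ),
      (isExtension_iff.1 hF).2, (isExtension_iff.1 hG').2, muBar, integral_add_measure]
    · exact integrable_hat_mul φ hf1
    · exact integrable_hat_mul φ (hf.mono_measure hle2)
  · refine (eLpNorm_add_le hF.1.1 hG'.1.1 (by norm_num)).trans ?_
    rw [hGn]
    calc _ ≤ C * S ^ (1 / 4 : ℝ) + C * S ^ (1 / 4 : ℝ) :=
          add_le_add (hFle.trans (by gcongr)) (hGle.trans (by gcongr))
      _ = _ := by push_cast; ring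

/-! ### The dyadic refinements and non-vanishing -/

theorem extensionNorm_eq {ν : Measure R4} {f F : R4 → ℂ} (h : IsExtension ν f F) :
    extensionNorm ν f = eLpNorm F 4 volume :=
  le_antisymm (iInf₂_le F h) (le_iInf₂ fun _ hG => (eLpNorm_congr_ae (h.ae_eq hG)).le)

theorem tsum_eLpNorm_dyadicPiece_sq_le (f : R4 → ℂ) (ν : Measure R4) :
    ∑' k, eLpNorm (dyadicPiece f k) 2 ν ^ 2 ≤ eLpNorm f 2 ν ^ 2 := by
  simp_rw [eLpNorm_dyadicPiece, eLpNorm_two_sq]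
  rw [← lintegral_iUnion measurableSet_annulus pairwise_disjoint_annulus]
  exact setLIntegral_le_lintegral _ _

theorem eLpNorm_dyadicPiece_le (f : R4 → ℂ) (k : ℕ) (ν : Measure R4) :
    eLpNorm (dyadicPiece f k) 2 ν ≤ eLpNorm f 2 ν := by
  rw [eLpNorm_dyadicPiece]
  exact eLpNorm_mono_measure _ Measure.restrict_le_self

/-- The inclusion of `ℓ³` in `ℓ⁴`: each `a k` is at most the `ℓ³` norm, so one factor of `a k ^ 4`
can be pulled out. -/
theorem tsum_pow_four_rpow_le (a : ℕ → ℝ≥0∞) :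
    (∑' k, a k ^ 4) ^ (1 / 4 : ℝ) ≤ (∑' k, a k ^ 3) ^ (1 / 3 : ℝ) := by
  set S := ∑' k, a k ^ 3 with hS
  have h1 : ∀ k, a k ≤ S ^ (1 / 3 : ℝ) := fun k => by
    have h := ENNReal.rpow_le_rpow (z := 1 / 3) (ENNReal.le_tsum (f := fun k => a k ^ 3) k)
      (by norm_num)
    rw [← ENNReal.rpow_natCast, ← ENNReal.rpow_mul] at h
    norm_num at h
    simpa [hS] using h
  have h2 : ∑' k, a k ^ 4 ≤ S ^ (4 / 3 : ℝ) := by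
    calc ∑' k, a k ^ 4 ≤ ∑' k, S ^ (1 / 3 : ℝ) * a k ^ 3 :=
          ENNReal.tsum_le_tsum fun k => by
            rw [pow_succ']
            gcongr
            exact h1 k
      _ = S ^ (1 / 3 : ℝ) * S ^ (1 : ℝ) := by rw [ENNReal.tsum_mul_left, ENNReal.rpow_one]
      _ = S ^ (4 / 3 : ℝ) := by
          rw [← ENNReal.rpow_add_of_nonneg _ _ (by norm_num) (by norm_num)]
          norm_num
  calc _ ≤ (S ^ (4 / 3 : ℝ)) ^ (1 / 4 : ℝ) := ENNReal.rpow_le_rpow h2 (by norm_num)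
    _ = S ^ (1 / 3 : ℝ) := by
        rw [← ENNReal.rpow_mul]
        norm_num

theorem DyadicBound.extensionNorm_le {ν : Measure R4} (h : DyadicBound ν) :
    ∃ C : ℝ≥0, ∀ f : R4 → ℂ, MemLp f 2 ν → extensionNorm ν f ≤
      C * (∑' k, eLpNorm (dyadicPiece f k) 2 ν ^ 3) ^ (1 / 3 : ℝ) := by
  obtain ⟨C, hC⟩ := h
  refine ⟨C, fun f hf => ?_⟩
  -- Orthogonality of the pieces shows that the finiteness hypothesis in `DyadicBound` holds for
  -- every `f` in `L²`.
  have h1 : ∑' k, eLpNorm (dyadicPiece f k) 2 ν ^ 4 ≤ eLpNorm f 2 ν ^ 2 * eLpNorm f 2 ν ^ 2 := by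
    calc _ ≤ ∑' k, eLpNorm f 2 ν ^ 2 * eLpNorm (dyadicPiece f k) 2 ν ^ 2 :=
          ENNReal.tsum_le_tsum fun k => by
            rw [show 4 = 2 + 2 from rfl, pow_add]
            gcongr
            exact eLpNorm_dyadicPiece_le f k ν
      _ ≤ _ := by
          rw [ENNReal.tsum_mul_left]
          exact mul_le_mul_right (tsum_eLpNorm_dyadicPiece_sq_le f ν) _
  obtain ⟨F, hF, hle⟩ := hC f hf (ne_top_of_le_ne_top (ENNReal.mul_ne_top
    (ENNReal.pow_ne_top hf.2.ne) (ENNReal.pow_ne_top hf.2.ne)) h1)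
  rw [extensionNorm_eq hF]
  exact hle.trans (mul_le_mul_right (tsum_pow_four_rpow_le _) _)

theorem tsum_pow_three_rpow_le (f : R4 → ℂ) (ν : Measure R4) :
    (∑' k, eLpNorm (dyadicPiece f k) 2 ν ^ 3) ^ (1 / 3 : ℝ) ≤
      (⨆ k, eLpNorm (dyadicPiece f k) 2 ν ^ (1 / 3 : ℝ)) * eLpNorm f 2 ν ^ (2 / 3 : ℝ) := by
  set T := ⨆ k, eLpNorm (dyadicPiece f k) 2 ν ^ (1 / 3 : ℝ) with hT
  have h1 : ∀ k, eLpNorm (dyadicPiece f k) 2 ν ≤ T ^ 3 := fun k => by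
    have h2 := pow_le_pow_left₀ zero_le
      (le_iSup (fun k => eLpNorm (dyadicPiece f k) 2 ν ^ (1 / 3 : ℝ)) k) 3
    rw [← ENNReal.rpow_natCast, ← ENNReal.rpow_mul] at h2
    norm_num at h2
    simpa [hT] using h2
  have h2 : ∑' k, eLpNorm (dyadicPiece f k) 2 ν ^ 3 ≤ T ^ 3 * eLpNorm f 2 ν ^ 2 := by
    calc _ ≤ ∑' k, T ^ 3 * eLpNorm (dyadicPiece f k) 2 ν ^ 2 :=
          ENNReal.tsum_le_tsum fun k => by
            rw [pow_succ' _ 2]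
            gcongr
            exact h1 k
      _ ≤ _ := by
          rw [ENNReal.tsum_mul_left]
          exact mul_le_mul_right (tsum_eLpNorm_dyadicPiece_sq_le f ν) _
  refine (ENNReal.rpow_le_rpow h2 (by norm_num)).trans_eq ?_
  rw [ENNReal.mul_rpow_of_nonneg _ _ (by norm_num), ← ENNReal.rpow_natCast, ← ENNReal.rpow_natCast,
    ← ENNReal.rpow_mul, ← ENNReal.rpow_mul]
  norm_num

theorem DyadicBound.extensionNorm_le_iSup {ν : Measure R4} (h : DyadicBound ν) :
    ∃ C : ℝ≥0, ∀ f : R4 → ℂ, MemLp f 2 ν → extensionNorm ν f ≤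
      C * (⨆ k, eLpNorm (dyadicPiece f k) 2 ν ^ (1 / 3 : ℝ)) * eLpNorm f 2 ν ^ (2 / 3 : ℝ) := by
  obtain ⟨C, hC⟩ := h.extensionNorm_le
  refine ⟨C, fun f hf => (hC f hf).trans ?_⟩
  rw [mul_assoc]
  exact mul_le_mul_right (tsum_pow_three_rpow_le f ν) _

/-- The integrable weight is bounded below on balls. Local finiteness makes `L²(ν)` functions
locally integrable, so compactly supported smooth functions can detect them. -/
theorem isLocallyFiniteMeasure_of_hasTemperateGrowth (ν : Measure R4) [hν : ν.HasTemperateGrowth] :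
    IsLocallyFiniteMeasure ν := by
  obtain ⟨n, hn⟩ := hν.exists_integrable
  refine ⟨fun x => ⟨Metric.ball 0 (‖x‖ + 1), Metric.isOpen_ball.mem_nhds (by simp), ?_⟩⟩
  have hpos : 0 < (1 + (‖x‖ + 1)) ^ (-(n : ℝ)) := by positivity
  refine (measure_mono fun y hy => ?_).trans_lt (hn.measure_norm_ge_lt_top hpos)
  rw [Metric.mem_ball, dist_zero_right] at hy
  simp only [Set.mem_ofPred_eq]
  rw [Real.norm_of_nonneg (by positivity)]
  exact Real.rpow_le_rpow_of_nonpos (by positivity) (by linarith) (by simp)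

/-- The adjoint restriction operator is injective. -/
theorem IsExtension.ae_eq_zero {ν : Measure R4} [ν.HasTemperateGrowth] {f F : R4 → ℂ}
    (hf : MemLp f 2 ν) (h : IsExtension ν f F) (hF : eLpNorm F 4 volume = 0) : f =ᵐ[ν] 0 := by
  have := isLocallyFiniteMeasure_of_hasTemperateGrowth ν
  have hF0 : F =ᵐ[volume] 0 := (eLpNorm_eq_zero_iff h.1.1 (by norm_num)).1 hF
  refine ae_eq_zero_of_integral_contDiff_smul_eq_zero (hf.locallyIntegrable one_le_two)
    fun g hg hc => ?_
  have hc' : HasCompactSupport (fun z => (g z : ℂ)) :=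
    hc.comp_left (g := fun x : ℝ => (x : ℂ)) (by simp)
  have hg' : ContDiff ℝ (⊤ : ℕ∞) (fun z => (g z : ℂ)) := Complex.ofRealCLM.contDiff.comp hg
  -- Choose `φ` whose transform is the given bump function `g`; pairing `F = 0` with `φ` shows that
  -- `∫ g f dν = 0`.
  obtain ⟨φ, hφ⟩ := hat_surjective (hc'.toSchwartzMap hg')
  have h1 := (isExtension_iff.1 h).2 φ
  have h2 : ∫ z, F z * φ z = 0 :=
    integral_eq_zero_of_ae (by filter_upwards [hF0] with z hz; simp [hz])
  rw [h2, hφ] at h1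
  simpa using h1.symm

theorem iSup_eLpNorm_dyadicPiece_le (f : R4 → ℂ) (ν : Measure R4) :
    ⨆ k, eLpNorm (dyadicPiece f k) 2 ν ^ (1 / 3 : ℝ) ≤
      (⨆ ℓ : ℕ, ∫⁻ ξ in {ξ : R4 | (2 : ℝ) ^ ((ℓ : ℝ) - 1) ≤ ‖ξ.fst‖ ∧
        ‖ξ.fst‖ ≤ (2 : ℝ) ^ ((ℓ : ℝ) + 1)}, ‖f ξ‖ₑ ^ 2 ∂ν) ^ (1 / 6 : ℝ) := by
  refine iSup_le fun k => ?_
  have h1 : eLpNorm (dyadicPiece f k) 2 ν ^ (1 / 3 : ℝ) =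
      (∫⁻ ξ in annulus k, ‖f ξ‖ₑ ^ 2 ∂ν) ^ (1 / 6 : ℝ) := by
    rw [← eLpNorm_two_sq, eLpNorm_dyadicPiece, ← ENNReal.rpow_natCast, ← ENNReal.rpow_mul]
    norm_num
  rw [h1]
  refine ENNReal.rpow_le_rpow ?_ (by norm_num)
  -- `R = 1` suffices: the annulus of index `k` lies in the closed shell centred at `ℓ = k`.
  refine le_iSup_of_le k (lintegral_mono_set fun ξ hξ => ?_)
  refine ⟨le_trans ?_ hξ.1, hξ.2.le.trans_eq ?_⟩
  · rw [← Real.rpow_natCast]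
    exact Real.rpow_le_rpow_of_exponent_le one_le_two (by linarith)
  · rw [← Real.rpow_natCast]
    push_cast
    rfl

theorem DyadicBound.not_isVanishing {ν : Measure R4} [ν.HasTemperateGrowth] (h : DyadicBound ν)
    {f : ℕ → R4 → ℂ} (hf : IsExtremizingSeq ν f) {n : ℕ → ℕ} (hn : StrictMono n) :
    ¬ IsVanishing ν fun j => f (n j) := by
  intro hv
  obtain ⟨C, hC⟩ := h.extensionNorm_le_iSup
  have hv1 := hv 1
  have hlim : Tendsto (fun j => extensionNorm ν (f (n j))) atTop (𝓝 0) := by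
    have h1 : Tendsto (fun j => (C : ℝ≥0∞) * (⨆ ℓ : ℕ, ∫⁻ ξ in {ξ : R4 |
        (2 : ℝ) ^ ((ℓ : ℝ) - 1) ≤ ‖ξ.fst‖ ∧ ‖ξ.fst‖ ≤ (2 : ℝ) ^ ((ℓ : ℝ) + 1)},
        ‖f (n j) ξ‖ₑ ^ 2 ∂ν) ^ (1 / 6 : ℝ)) atTop (𝓝 0) := by
      have h2 := ((ENNReal.continuous_rpow_const (y := 1 / 6)).tendsto 0).comp hv1
      rw [ENNReal.zero_rpow_of_pos (by norm_num)] at h2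
      have h3 := ENNReal.Tendsto.const_mul h2 (Or.inr (ENNReal.coe_ne_top (r := C)))
      rwa [mul_zero] at h3
    refine tendsto_of_tendsto_of_tendsto_of_le_of_le tendsto_const_nhds h1 (fun j => zero_le)
      fun j => ?_
    refine (hC _ (hf.memLp _)).trans ?_
    rw [hf.norm_eq_one, ENNReal.one_rpow, mul_one]
    exact mul_le_mul_right (iSup_eLpNorm_dyadicPiece_le _ ν) _
  -- The extension norms tend to the best constant by extremality and to 0 by vanishing. Hence `f
  -- 0`, of norm 1, has extension norm 0, contradicting injectivity.
  have hbest : bestConstant ν = 0 :=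
    tendsto_nhds_unique (hf.tendsto.comp hn.tendsto_atTop) hlim
  have hne : eLpNorm (f 0) 2 ν ≠ 0 := by rw [hf.norm_eq_one]; exact one_ne_zero
  have h0 : extensionNorm ν (f 0) = 0 := by
    have h1 : extensionNorm ν (f 0) / eLpNorm (f 0) 2 ν ≤ bestConstant ν :=
      le_iSup_of_le (f 0) (le_iSup_of_le (hf.memLp 0) (le_iSup_of_le hne le_rfl))
    rw [hbest, hf.norm_eq_one, div_one] at h1
    exact le_antisymm h1 zero_le
  -- Without an `L⁴` extension the infimum would be over the empty family and equal `∞`, not 0.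
  obtain ⟨F, hF⟩ : ∃ F, IsExtension ν (f 0) F := by
    by_contra! hcon
    have : extensionNorm ν (f 0) = ∞ := by simp [extensionNorm, hcon]
    simp [this] at h0
  refine hne ?_
  rw [eLpNorm_congr_ae (hF.ae_eq_zero (hf.memLp 0) ((extensionNorm_eq hF).symm.trans h0))]
  exact eLpNorm_zero

end Hyperboloid

end

theorem mainTheorem8 :
    -- the dyadic refinement for `T` and for `T̄`
    (∃ C : ℝ≥0, ∀ f : Hyperboloid.R4 → ℂ, MemLp f 2 Hyperboloid.mu →
      Hyperboloid.extensionNorm Hyperboloid.mu f ≤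
        C * (∑' k : ℕ, eLpNorm (Hyperboloid.dyadicPiece f k) 2 Hyperboloid.mu ^ 3) ^ (1 / 3 : ℝ)) ∧
    (∃ C : ℝ≥0, ∀ f : Hyperboloid.R4 → ℂ, MemLp f 2 Hyperboloid.muBar →
      Hyperboloid.extensionNorm Hyperboloid.muBar f ≤
        C * (∑' k : ℕ, eLpNorm (Hyperboloid.dyadicPiece f k) 2 Hyperboloid.muBar ^ 3) ^
          (1 / 3 : ℝ)) ∧
    -- the bound by the largest dyadic piece for `T` and for `T̄`
    (∃ C : ℝ≥0, ∀ f : Hyperboloid.R4 → ℂ, MemLp f 2 Hyperboloid.mu →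
      Hyperboloid.extensionNorm Hyperboloid.mu f ≤
        C * (⨆ k : ℕ, eLpNorm (Hyperboloid.dyadicPiece f k) 2 Hyperboloid.mu ^ (1 / 3 : ℝ)) *
          eLpNorm f 2 Hyperboloid.mu ^ (2 / 3 : ℝ)) ∧
    (∃ C : ℝ≥0, ∀ f : Hyperboloid.R4 → ℂ, MemLp f 2 Hyperboloid.muBar →
      Hyperboloid.extensionNorm Hyperboloid.muBar f ≤
        C * (⨆ k : ℕ, eLpNorm (Hyperboloid.dyadicPiece f k) 2 Hyperboloid.muBar ^ (1 / 3 : ℝ)) *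
          eLpNorm f 2 Hyperboloid.muBar ^ (2 / 3 : ℝ)) ∧
    -- no subsequence of an extremizing sequence, for `T` or for `T̄`, is vanishing
    (∀ f : ℕ → Hyperboloid.R4 → ℂ, Hyperboloid.IsExtremizingSeq Hyperboloid.mu f →
      ∀ n : ℕ → ℕ, StrictMono n → ¬ Hyperboloid.IsVanishing Hyperboloid.mu (fun j => f (n j))) ∧
    (∀ f : ℕ → Hyperboloid.R4 → ℂ, Hyperboloid.IsExtremizingSeq Hyperboloid.muBar f →
      ∀ n : ℕ → ℕ, StrictMono n →
        ¬ Hyperboloid.IsVanishing Hyperboloid.muBar (fun j => f (n j))) := by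
  exact ⟨Hyperboloid.dyadicBound_mu.extensionNorm_le, Hyperboloid.dyadicBound_muBar.extensionNorm_le,
    Hyperboloid.dyadicBound_mu.extensionNorm_le_iSup,
    Hyperboloid.dyadicBound_muBar.extensionNorm_le_iSup,
    fun _ hf _ hn => Hyperboloid.dyadicBound_mu.not_isVanishing hf hn,
    fun _ hf _ hn => Hyperboloid.dyadicBound_muBar.not_isVanishing hf hn⟩
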